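/- Let $n\in\mathbb N$ and $\ell>0$. An $n$-dimensional charge is a $\sigma$-additive function $\mu=(\mu_1,\dots,\mu_n)$ from the Borel sets of $\mathbb R^n$ to $\mathbb R^n$; it acts on bounded measurable vector fields by $\langle\mu,\varphi\rangle=\sum_k\int\varphi_k\,d\mu_k$, $\|\mu\|$ denotes its variation measure (with respect to the Euclidean norm), $\operatorname{Var}(\mu)=\|\mu\|(\mathbb R^n)$, and $\operatorname{supp}(\mu)$ is the support of $\|\mu\|$. The charge is divergence free, $\operatorname{Div}(\mu)=0$, if $\langle\mu,\nabla\psi\rangle=0$ for all $\psi\in C_c^\infty(\mathbb R^n)$. Let $K_\ell$ be the set of Lipschitz curves $\gamma:[0,\ell]\to\mathbb R^n$ with $|\dot\gamma|\le 1$ almost everywhere, with the topology of uniform convergence and its Borel $\sigma$-algebra. For $\gamma\in K_\ell$ let $L(\gamma)=\int_0^\ell|\dot\gamma(t)|\,dt$, and let $[\gamma]$ be the charge $[\gamma](A)=\int_{\{t\in[0,\ell]:\gamma(t)\in A\}}\dot\gamma(t)\,dt$, so that $\langle[\gamma],\varphi\rangle=\int_0^\ell\langle\varphi(\gamma(t)),\dot\gamma(t)\rangle\,dt$.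 **Proposition.** For every $\ell>0$ and every $n$-dimensional charge $\mu$ with $\operatorname{Div}(\mu)=0$ there is a finite positive Borel measure $\nu$ on $K_\ell$ which has all of the following properties: 1. $\mu=\int_{K_\ell}[\gamma]\,d\nu(\gamma)$, i.e. $\gamma\mapsto\langle[\gamma],\varphi\rangle$ is $\nu$-integrable and $\langle\mu,\varphi\rangle=\int_{K_\ell}\langle[\gamma],\varphi\rangle\,d\nu(\gamma)$ for every continuous compactly supported field $\varphi:\mathbb R^n\to\mathbb R^n$; 2. $\|\mu\|=\int_{K_\ell}\|[\gamma]\|\,d\nu(\gamma)$; 3. $\nu$-almost every $\gamma\in K_\ell$ has all its values in $\operatorname{supp}(\mu)$ and satisfies $\operatorname{Var}([\gamma])=L(\gamma)=\ell$; 4. $\|\mu\|=\ell\int_{K_\ell}\delta_{\gamma(0)}\,d\nu(\gamma)=\ell\int_{K_\ell}\delta_{\gamma(\ell)}\,d\nu(\gamma)$. Here the identities between positive measures in 2 and 4 mean equality on every Borel set $E\subseteq\mathbb R^n$, the integrands ($\|[\gamma]\|(E)$, resp. $\delta_{\gamma(0)}(E)$ and $\delta_{\gamma(\ell)}(E)$)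 being $\nu$-measurable functions of $\gamma$. -/

import Mathlib

open MeasureTheory
open scoped ContDiff ENNReal NNReal

noncomputable section

/-- An `n`-dimensional charge: a `σ`-additive function from the Borel sets of `ℝⁿ` to `ℝⁿ`. Its
variation measure is `VectorMeasure.variation`. -/
abbrev Charge (n : ℕ) : Type :=
  VectorMeasure (EuclideanSpace ℝ (Fin n)) (EuclideanSpace ℝ (Fin n))

/-- The action `⟨μ, φ⟩ = ∑ₖ ∫ φₖ dμₖ` of a charge on a vector field: the integral of `φ` against
the vector measure `μ`, paired through the Euclidean scalar product. -/
def Charge.act {n : ℕ} (μ : Charge n)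
    (φ : EuclideanSpace ℝ (Fin n) → EuclideanSpace ℝ (Fin n)) : ℝ :=
  VectorMeasure.integral μ φ (innerSL ℝ)

/-- The distributional divergence `⟨Div μ, ψ⟩ = -⟨μ, ∇ψ⟩`. -/
def Charge.div {n : ℕ} (μ : Charge n) (ψ : EuclideanSpace ℝ (Fin n) → ℝ) : ℝ :=
  - μ.act (gradient ψ)

/-- `Div μ = 0` as a distribution. -/
def Charge.DivergenceFree {n : ℕ} (μ : Charge n) : Prop :=
  ∀ ψ : EuclideanSpace ℝ (Fin n) → ℝ, ContDiff ℝ ∞ ψ → HasCompactSupport ψ → μ.div ψ = 0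

/-- The support of a charge, i.e. of its variation measure. -/
def Charge.supp {n : ℕ} (μ : Charge n) : Set (EuclideanSpace ℝ (Fin n)) :=
  μ.variation.support

section Curves

variable {n : ℕ} {ℓ : ℝ} (hℓ : 0 < ℓ)

/-- The Borel `σ`-algebra of the uniform norm on `C([0, ℓ], ℝⁿ)`; subsets of this space carry the
induced topology and `σ`-algebra. -/
instance instMeasurableSpaceCurves :
    MeasurableSpace C(Set.Icc (0 : ℝ) ℓ, EuclideanSpace ℝ (Fin n)) :=
  borel _

instance instBorelSpaceCurves : BorelSpace C(Set.Icc (0 : ℝ) ℓ, EuclideanSpace ℝ (Fin n)) :=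
  ⟨rfl⟩

/-- The curve `γ`, continued by constants to the real line. -/
def curveExt (γ : C(Set.Icc (0 : ℝ) ℓ, EuclideanSpace ℝ (Fin n))) :
    ℝ → EuclideanSpace ℝ (Fin n) :=
  Set.IccExtend hℓ.le γ

/-- The derivative of `γ`; only its values at points of differentiability in `(0, ℓ)` matter. -/
def velocity (γ : C(Set.Icc (0 : ℝ) ℓ, EuclideanSpace ℝ (Fin n))) :
    ℝ → EuclideanSpace ℝ (Fin n) :=
  deriv (curveExt hℓ γ)

variable (n) in
/-- The set `K_ℓ` of Lipschitz curves `γ : [0, ℓ] → ℝⁿ` with `|γ'| ≤ 1` almost everywhere. -/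
def lipCurves : Set C(Set.Icc (0 : ℝ) ℓ, EuclideanSpace ℝ (Fin n)) :=
  {γ | (∃ C : ℝ≥0, LipschitzWith C γ) ∧
    ∀ᵐ t ∂(volume.restrict (Set.Icc 0 ℓ)), ‖velocity hℓ γ t‖ ≤ 1}

/-- The charge `[γ]`: the push-forward under `γ` of the vector measure `γ' · λ¹` on `[0, ℓ]`. -/
def curveCharge (γ : C(Set.Icc (0 : ℝ) ℓ, EuclideanSpace ℝ (Fin n))) : Charge n :=
  ((volume.restrict (Set.Icc 0 ℓ)).withDensityᵥ (velocity hℓ γ)).map (curveExt hℓ γ)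

/-- The length `L(γ) = ∫ |γ'| dλ¹`. -/
def curveLength (γ : C(Set.Icc (0 : ℝ) ℓ, EuclideanSpace ℝ (Fin n))) : ℝ≥0∞ :=
  ∫⁻ t in Set.Icc 0 ℓ, ‖velocity hℓ γ t‖ₑ

/-- `μ = ∫ [γ] dν(γ)` in the weak sense: `⟨μ, φ⟩ = ∫ ⟨[γ], φ⟩ dν(γ)` for all continuous compactly
supported fields `φ`. -/
def IsChargeIntegral (μ : Charge n) (ν : Measure (lipCurves n hℓ)) : Prop :=
  ∀ φ : EuclideanSpace ℝ (Fin n) → EuclideanSpace ℝ (Fin n),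
    Continuous φ → HasCompactSupport φ →
      Integrable (fun γ : lipCurves n hℓ => (curveCharge hℓ γ.1).act φ) ν ∧
        μ.act φ = ∫ γ : lipCurves n hℓ, (curveCharge hℓ γ.1).act φ ∂ν

end Curves

/-- `ρ = ∫ κ_γ dν(γ)` for positive measures: `ρ(E) = ∫ κ_γ(E) dν(γ)` for all measurable `E`. -/
def IsMeasureIntegral {X Y : Type*} [MeasurableSpace X] [MeasurableSpace Y]
    (ρ : Measure X) (κ : Y → Measure X) (ν : Measure Y) : Prop :=
  ∀ E : Set X, MeasurableSet E →
    AEMeasurable (fun y => κ y E) ν ∧ ρ E = ∫⁻ y, κ y E ∂ν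

end

/-! Write `μ = b ρ` with `ρ = ‖μ‖` and `|b| = 1` `ρ`-almost everywhere
(`VectorMeasure.exists_withDensityᵥ_variation`). Then `Div μ = 0` says that the constant family `ρ`
solves the continuity equation of the field `b`. The superposition principle
(`exists_superposition`) turns this stationary solution into a finite measure `ζ` on curves with `γ'
= b(γ)`, all of whose one-time marginals are `ρ`. The measure sought is `ζ / ℓ`.

Along such a curve the velocity depends on the position only, so `[γ]` is `b` times the occupation
measure of `γ` and nothing cancels where the curve revisits a point. The occupation measures have
`ζ`-average `ℓ ρ`. Hence almost every curve spends almost all its time where `|b| = 1`, so that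
`‖[γ]‖` is its occupation measure, of mass `ℓ`. Integrating over `ζ` gives 1 and 2; the marginals
give 4; the support is closed and carries every marginal, which gives 3.

For the superposition principle, `ρ` and `b ρ` are convolved with a kernel `K` whose logarithm is
Lipschitz. The quotient `V = (K * bρ) / (K * ρ)` is then bounded by 1 and globally Lipschitz, and `V
(K * ρ)` is divergence free. The flow of `V` preserves `K * ρ` (`map_flow_eq`), and its trajectories
carry a measure on curves with all marginals equal to `K * ρ`
(`LipschitzWith.exists_measure_curves`). These measures are tight as the kernel shrinks. In the
limit the integral equation for `b` survives although `b` is only Borel: `b` is compared with a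
continuous field `c` close to it in `L¹(ρ)`, and `L¹` errors of fields control the mean errors along
curves because the marginals are known (`lintegral_enorm_integral_IccExtend_le`,
`IsMollifier.lintegral_enorm_mollifiedField_sub_le`). -/

/-! ### Vector measures: finite variation, polar decomposition, integration. -/

/-- The variation is dominated by the sum of the total variations of the coordinates, which are
finite because these are real signed measures. -/
theorem VectorMeasure.isFiniteMeasure_variation_euclideanSpace {X : Type*} [MeasurableSpace X]
    {ι : Type*} [Fintype ι] (μ : VectorMeasure X (EuclideanSpace ℝ ι)) :
    IsFiniteMeasure μ.variation := by
  classical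
  let s : ι → SignedMeasure X := fun i =>
    μ.mapRange (EuclideanSpace.proj (𝕜 := ℝ) i :
        EuclideanSpace ℝ ι →L[ℝ] ℝ).toLinearMap.toAddMonoidHom
      (EuclideanSpace.proj (𝕜 := ℝ) i : EuclideanSpace ℝ ι →L[ℝ] ℝ).continuous
  have hle : μ.variation ≤ ∑ i, (s i).totalVariation := by
    apply VectorMeasure.variation_le_of_forall_enorm_le
    intro A hA
    have h1 : μ A = ∑ i, EuclideanSpace.single i (s i A) := by
      ext j
      have hj : s j A = (μ A) j := rfl
      simp [Finset.sum_apply, Pi.single_apply, hj]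
    rw [h1, Measure.finsetSum_apply]
    refine (enorm_sum_le _ _).trans (Finset.sum_le_sum fun i _ => ?_)
    have : ‖EuclideanSpace.single i (s i A)‖ₑ = ‖s i A‖ₑ := by
      simp [← ofReal_norm]
    rw [this]
    exact (s i).enorm_le_totalVariation A
  exact isFiniteMeasure_of_le _ hle

/-- Polar decomposition of a vector measure with values in a Euclidean space. -/
theorem VectorMeasure.exists_withDensityᵥ_variation {X : Type*} [MeasurableSpace X]
    {ι : Type*} [Fintype ι] (μ : VectorMeasure X (EuclideanSpace ℝ ι)) :
    ∃ b : X → EuclideanSpace ℝ ι, Measurable b ∧ (∀ x, ‖b x‖ ≤ 1) ∧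
      (∀ᵐ x ∂μ.variation, ‖b x‖ = 1) ∧ μ = μ.variation.withDensityᵥ b := by
  classical
  have := VectorMeasure.isFiniteMeasure_variation_euclideanSpace μ
  let s : ι → SignedMeasure X := fun i =>
    μ.mapRange (EuclideanSpace.proj (𝕜 := ℝ) i :
        EuclideanSpace ℝ ι →L[ℝ] ℝ).toLinearMap.toAddMonoidHom
      (EuclideanSpace.proj (𝕜 := ℝ) i : EuclideanSpace ℝ ι →L[ℝ] ℝ).continuous
  have hs : ∀ i, μ.variation.withDensityᵥ ((s i).rnDeriv μ.variation) = s i := fun i => by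
    apply SignedMeasure.withDensityᵥ_rnDeriv_eq
    refine VectorMeasure.AbsolutelyContinuous.mk fun A hA h0 => ?_
    rw [Measure.toENNRealVectorMeasure_apply_measurable hA] at h0
    have h1 : μ A = 0 := by
      have := VectorMeasure.enorm_measure_le_variation μ A
      rw [h0] at this
      simpa using this
    have hi : s i A = (μ A) i := rfl
    simp [hi, h1]
  let f : X → EuclideanSpace ℝ ι := fun x => WithLp.toLp 2 fun i => (s i).rnDeriv μ.variation x
  have hfm : Measurable f := by
    refine (WithLp.measurable_toLp _ _).comp (measurable_pi_iff.2 fun i => ?_)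
    exact SignedMeasure.measurable_rnDeriv _ _
  have hfi : Integrable f μ.variation := by
    have : f = fun x => ∑ i, EuclideanSpace.single i ((s i).rnDeriv μ.variation x) := by
      ext x j
      simp [f, Pi.single_apply]
    rw [this]
    refine integrable_finsetSum _ fun i _ => ?_
    have hsmul : (fun x => EuclideanSpace.single i ((s i).rnDeriv μ.variation x)) =
        fun x => (s i).rnDeriv μ.variation x • EuclideanSpace.single i (1 : ℝ) := by
      ext x j
      simp
    rw [hsmul]
    exact (SignedMeasure.integrable_rnDeriv _ _).smul_const _
  have hμ : μ = μ.variation.withDensityᵥ f := by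
    ext A hA j
    rw [withDensityᵥ_apply hfi hA]
    have h2 : (∫ x in A, f x ∂μ.variation) j = ∫ x in A, f x j ∂μ.variation :=
      ((EuclideanSpace.proj (𝕜 := ℝ) j : EuclideanSpace ℝ ι →L[ℝ] ℝ).integral_comp_comm
        hfi.integrableOn).symm
    have h3 : s j A = ∫ x in A, (s j).rnDeriv μ.variation x ∂μ.variation := by
      conv_lhs => rw [← hs j]
      rw [withDensityᵥ_apply (SignedMeasure.integrable_rnDeriv _ _) hA]
    rw [h2]
    exact h3
  -- Taking variations in `μ = f |μ|` gives `|μ| = |f| |μ|`; uniqueness of densities then forces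
  -- `|f| = 1` almost everywhere.
  have hv : μ.variation = μ.variation.withDensity fun x => ‖f x‖ₑ := by
    rw [← Measure.variation_withDensityᵥ hfi, ← hμ]
  have h1 : ∀ᵐ x ∂μ.variation, ‖f x‖ = 1 := by
    have h := (withDensity_eq_iff (μ := μ.variation) (f := fun x => ‖f x‖ₑ) (g := 1) (by fun_prop)
      aemeasurable_const hfi.2.ne).1 (by rw [withDensity_one]; exact hv.symm)
    filter_upwards [h] with x hx
    have : ‖f x‖ₑ = 1 := hx
    rw [← toReal_enorm, this]; simp
  -- Changing `f` on a null set makes the bound by 1 hold everywhere, hence along every curve.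
  refine ⟨fun x => if ‖f x‖ = 1 then f x else 0, ?_, ?_, ?_, ?_⟩
  · exact Measurable.ite (measurableSet_eq_fun (by fun_prop) measurable_const) hfm measurable_const
  · intro x
    dsimp only
    split_ifs with h <;> simp [h]
  · filter_upwards [h1] with x hx
    simp [hx]
  · conv_lhs => rw [hμ]
    refine WithDensityᵥEq.congr_ae ?_
    filter_upwards [h1] with x hx
    simp [hx]

/-- Both sides agree on indicators. Since `|b| = 1`, the variation of `b ρ` is `ρ`, so both sides
are continuous in `L¹(ρ)` and density of simple functions finishes the proof. -/
theorem Measure.integral_withDensityᵥ_of_norm_eq_one {X E F G : Type*} [MeasurableSpace X]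
    [NormedAddCommGroup E] [NormedSpace ℝ E]
    [NormedAddCommGroup F] [NormedSpace ℝ F] [CompleteSpace F]
    [NormedAddCommGroup G] [NormedSpace ℝ G] [CompleteSpace G]
    (B : E →L[ℝ] F →L[ℝ] G) {ρ : Measure X} [IsFiniteMeasure ρ] {b : X → F}
    (hb : AEStronglyMeasurable b ρ) (hb1 : ∀ᵐ x ∂ρ, ‖b x‖ = 1) {φ : X → E} (hφ : Integrable φ ρ) :
    VectorMeasure.integral (ρ.withDensityᵥ b) φ B = ∫ x, B (φ x) (b x) ∂ρ := by
  have hbi : Integrable b ρ := Integrable.of_bound hb 1 (hb1.mono fun x hx => hx.le)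
  have hv : (ρ.withDensityᵥ b).variation = ρ := by
    rw [Measure.variation_withDensityᵥ hbi]
    conv_rhs => rw [← withDensity_one (μ := ρ)]
    refine withDensity_congr_ae (hb1.mono fun x hx => ?_)
    change ‖b x‖ₑ = 1
    rw [← ofReal_norm, hx]; simp
  have hint : ∀ φ : X → E, Integrable φ ρ → Integrable (fun x => B (φ x) (b x)) ρ := fun φ hφ => by
    refine Integrable.mono' (hφ.norm.const_mul ‖B‖) ?_ ?_
    · exact B.aestronglyMeasurable_comp₂ hφ.aestronglyMeasurable hb
    · filter_upwards [hb1] with x hx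
      simpa [hx] using B.le_opNorm₂ (φ x) (b x)
  refine Integrable.induction (fun φ : X → E => VectorMeasure.integral (ρ.withDensityᵥ b) φ B =
    ∫ x, B (φ x) (b x) ∂ρ) ?_ ?_ ?_ ?_ hφ
  · intro c s hs hsf
    have : IsFiniteMeasure (ρ.withDensityᵥ b).variation := by rw [hv]; infer_instance
    rw [VectorMeasure.integral_indicator hs, VectorMeasure.integral_const,
      VectorMeasure.restrict_apply _ hs MeasurableSet.univ, Set.univ_inter,
      withDensityᵥ_apply hbi hs, ← (B c).integral_comp_comm hbi.integrableOn,
      ← integral_indicator hs]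
    refine integral_congr_ae (ae_of_all _ fun x => ?_)
    by_cases hx : x ∈ s <;> simp [hx]
  · intro f g _ hf hg h1 h2
    have e := VectorMeasure.integral_add (μ := ρ.withDensityᵥ b) (B := B) (f := f) (g := g)
      (by rw [VectorMeasure.Integrable, hv]; exact hf)
      (by rw [VectorMeasure.Integrable, hv]; exact hg)
    change VectorMeasure.integral (ρ.withDensityᵥ b) (fun x => (f + g) x) B = _
    rw [e, h1, h2, ← integral_add (hint f hf) (hint g hg)]
    simp
  · refine IsSeqClosed.isClosed fun f g hf hfg => ?_
    have hlim : Filter.Tendsto (fun k => ∫⁻ x, ‖f k x - g x‖ₑ ∂ρ) Filter.atTop (nhds 0) := by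
      have := tendsto_iff_edist_tendsto_0.1 hfg
      simpa [Lp.edist_def, eLpNorm_one_eq_lintegral_enorm] using this
    have t1 : Filter.Tendsto (fun k => VectorMeasure.integral (ρ.withDensityᵥ b) (f k) B)
        Filter.atTop (nhds (VectorMeasure.integral (ρ.withDensityᵥ b) g B)) := by
      refine VectorMeasure.tendsto_integral_of_L1 _ ?_ (Filter.Eventually.of_forall fun k => ?_) ?_
      · rw [hv]; exact (Lp.aestronglyMeasurable g)
      · rw [VectorMeasure.Integrable, hv]; exact L1.integrable_coeFn (f k)
      · rw [hv]; exact hlim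
    have t2 : Filter.Tendsto (fun k => ∫ x, B (f k x) (b x) ∂ρ)
        Filter.atTop (nhds (∫ x, B (g x) (b x) ∂ρ)) := by
      refine tendsto_integral_of_L1 _ (hint _ (L1.integrable_coeFn g)).1
        (Filter.Eventually.of_forall fun k => hint _ (L1.integrable_coeFn (f k))) ?_
      have hb2 := ENNReal.Tendsto.const_mul hlim (Or.inr (enorm_ne_top (x := B)))
      rw [mul_zero] at hb2
      refine tendsto_of_tendsto_of_tendsto_of_le_of_le tendsto_const_nhds hb2
        (fun _ => zero_le) fun k => ?_
      dsimp only
      rw [← lintegral_const_mul' _ _ enorm_ne_top]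
      refine lintegral_mono_ae (hb1.mono fun x hx => ?_)
      have hle := B.le_opNorm₂ (f k x - g x) (b x)
      rw [hx, mul_one] at hle
      rw [← sub_apply, ← map_sub, ← ofReal_norm, ← ofReal_norm, ← ofReal_norm,
        ← ENNReal.ofReal_mul (norm_nonneg _)]
      exact ENNReal.ofReal_le_ofReal hle
    exact tendsto_nhds_unique t1 (t2.congr fun k => (hf k).symm)
  · intro f g hfg hf h
    have hfg' : f =ᵐ[(ρ.withDensityᵥ b).variation] g := by rw [hv]; exact hfg
    change VectorMeasure.integral (ρ.withDensityᵥ b) g B = _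
    rw [← VectorMeasure.integral_congr_ae hfg', h]
    refine integral_congr_ae (hfg.mono fun x hx => ?_)
    simp only [hx]

/-! ### Mollifiers with polynomial tails. -/

/-- A positive bounded continuous density whose logarithm is Lipschitz in the weak sense that
increments are controlled by the values of the density. -/
structure IsMollifier {E : Type*} [NormedAddCommGroup E] (K : E → ℝ) (C M : ℝ) : Prop where
  continuous : Continuous K
  pos : ∀ x, 0 < K x
  le : ∀ x, K x ≤ M
  C_nonneg : 0 ≤ C
  abs_sub_le : ∀ x y, |K x - K y| ≤ C * ‖x - y‖ * (K x + K y)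

/-- For `a ≤ b`, Bernoulli's inequality and `b ≥ 1` give `(a / b) ^ p ≥ 1 - p (b - a)`; multiplying
by `(a ^ p)⁻¹` yields the bound, with only the larger of the two summands needed. -/
theorem abs_inv_pow_sub_inv_pow_le {a b : ℝ} (ha : 1 ≤ a) (hb : 1 ≤ b) (p : ℕ) :
    |(a ^ p)⁻¹ - (b ^ p)⁻¹| ≤ p * |a - b| * ((a ^ p)⁻¹ + (b ^ p)⁻¹) := by
  wlog hab : a ≤ b generalizing a b
  · have := this hb ha (le_of_not_ge hab)
    rwa [abs_sub_comm, abs_sub_comm b a, add_comm] at this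
  have ha0 : 0 < a := by linarith
  have hb0 : 0 < b := by linarith
  have hB : 1 + (p : ℝ) * ((a - b) / b) ≤ (1 + (a - b) / b) ^ p :=
    one_add_mul_le_pow (by
      have : (a - b) / b = a / b - 1 := by field_simp
      have h2 : 0 < a / b := by positivity
      linarith) p
  have h1 : 1 + (a - b) / b = a / b := by field_simp; ring
  rw [h1, div_pow] at hB
  have h2 : (a - b) ≤ (a - b) / b := by
    rw [le_div_iff₀ hb0]; nlinarith
  have h3 : 1 - p * (b - a) ≤ a ^ p / b ^ p := by
    refine le_trans ?_ hB
    have : (0 : ℝ) ≤ p := by positivity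
    nlinarith
  have h4 : (b ^ p)⁻¹ ≤ (a ^ p)⁻¹ := by gcongr
  rw [abs_of_nonneg (by linarith), abs_of_nonpos (by linarith)]
  have h5 : (b ^ p)⁻¹ = (a ^ p)⁻¹ * (a ^ p / b ^ p) := by field_simp
  have h6 : (0 : ℝ) < (a ^ p)⁻¹ := by positivity
  have h7 : (0 : ℝ) < (b ^ p)⁻¹ := by positivity
  calc (a ^ p)⁻¹ - (b ^ p)⁻¹ = (a ^ p)⁻¹ * (1 - a ^ p / b ^ p) := by rw [h5]; ring
    _ ≤ (a ^ p)⁻¹ * (p * (b - a)) := by gcongr; linarith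
    _ ≤ p * -(a - b) * ((a ^ p)⁻¹ + (b ^ p)⁻¹) := by
      have : 0 ≤ p * (b - a) := mul_nonneg (by positivity) (by linarith)
      nlinarith

/-- Polynomial decay keeps the logarithmic gradient bounded, by `p / ε`. A Gaussian would violate
the increment bound and a compactly supported bump the positivity. -/
theorem isMollifier_one_add_norm {E : Type*} [NormedAddCommGroup E] [NormedSpace ℝ E] (p : ℕ)
    {c ε : ℝ} (hc : 0 < c) (hε : 0 < ε) :
    IsMollifier (fun x : E => c * ((1 + ‖ε⁻¹ • x‖) ^ p)⁻¹) (p * ε⁻¹) c where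
  continuous := by
    refine continuous_const.mul (Continuous.inv₀ (by fun_prop) fun x => by positivity)
  pos x := by positivity
  le x := by
    have : (1 : ℝ) ≤ (1 + ‖ε⁻¹ • x‖) ^ p := one_le_pow₀ (by simp)
    exact mul_le_of_le_one_right hc.le (inv_le_one_of_one_le₀ this)
  C_nonneg := by positivity
  abs_sub_le x y := by
    have h := abs_inv_pow_sub_inv_pow_le (a := 1 + ‖ε⁻¹ • x‖) (b := 1 + ‖ε⁻¹ • y‖)
      (by simp) (by simp) p
    have h1 : |1 + ‖ε⁻¹ • x‖ - (1 + ‖ε⁻¹ • y‖)| ≤ ε⁻¹ * ‖x - y‖ := by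
      rw [add_sub_add_left_eq_sub]
      refine (abs_norm_sub_norm_le _ _).trans ?_
      rw [← smul_sub, norm_smul, Real.norm_of_nonneg (by positivity)]
    rw [← mul_sub, abs_mul, abs_of_pos hc]
    calc c * _ ≤ c * (p * (ε⁻¹ * ‖x - y‖) * (((1 + ‖ε⁻¹ • x‖) ^ p)⁻¹ + ((1 + ‖ε⁻¹ • y‖) ^ p)⁻¹)) :=
        by
          refine mul_le_mul_of_nonneg_left (h.trans ?_) hc.le
          gcongr
      _ = _ := by ring

section
variable {E : Type*} [NormedAddCommGroup E] [NormedSpace ℝ E] [FiniteDimensional ℝ E]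
  [MeasurableSpace E] [BorelSpace E]

theorem exists_mollifier_measure (vol : Measure E) [vol.IsAddHaarMeasure] :
    ∃ κ : Measure E, IsProbabilityMeasure κ ∧ ∀ ε : ℝ, 0 < ε → ∃ (K : E → ℝ) (C M : ℝ),
      IsMollifier K C M ∧
        κ.map (fun x => ε • x) = vol.withDensity (fun x => ENNReal.ofReal (K x)) := by
  -- An exponent above the dimension makes `K₀` integrable.
  set p := Module.finrank ℝ E + 1 with hp
  let K₀ : E → ℝ := fun x => ((1 + ‖x‖) ^ p)⁻¹
  have hK₀c : Continuous K₀ := Continuous.inv₀ (by fun_prop) fun x => by positivity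
  have hint : Integrable K₀ vol := by
    have := integrable_one_add_norm (μ := vol) (E := E) (r := (p : ℝ))
        (by rw [hp]; push_cast; linarith)
    refine this.congr (ae_of_all _ fun x => ?_)
    simp only [K₀]
    rw [Real.rpow_neg (by positivity), Real.rpow_natCast]
  have hpos : 0 < ∫ x, K₀ x ∂vol := by
    refine (integral_pos_iff_support_of_nonneg (fun x => by positivity) hint).2 ?_
    have : Function.support K₀ = Set.univ := by
      ext x
      have : 0 < K₀ x := by positivity
      simp [this.ne']
    rw [this]
    exact Measure.measure_univ_pos.2 (NeZero.ne vol)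
  set c := (∫ x, K₀ x ∂vol)⁻¹ with hc
  have hc0 : 0 < c := by positivity
  refine ⟨vol.withDensity fun x => ENNReal.ofReal (c * K₀ x), ⟨?_⟩, fun ε hε => ?_⟩
  · rw [withDensity_apply _ MeasurableSet.univ, Measure.restrict_univ,
      ← ofReal_integral_eq_lintegral_ofReal (hint.const_mul c) (ae_of_all _ fun x => by positivity),
      integral_const_mul, hc, inv_mul_cancel₀ hpos.ne', ENNReal.ofReal_one]
  -- The Jacobian factor of the dilation by `ε`.
  · set a := |(ε ^ Module.finrank ℝ E)⁻¹| with ha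
    have ha0 : 0 < a := by positivity
    refine ⟨fun x => (a * c) * K₀ (ε⁻¹ • x), _, _,
      isMollifier_one_add_norm p (by positivity : 0 < a * c) hε, ?_⟩
    have hmeas : Measurable fun x : E => ε • x := measurable_const_smul ε
    ext A hA
    rw [Measure.map_apply hmeas hA, withDensity_apply _ (hmeas hA), withDensity_apply _ hA,
      ← lintegral_indicator (hmeas hA), ← lintegral_indicator hA]
    have h1 : ∀ x, ((fun x => ε • x) ⁻¹' A).indicator (fun x => ENNReal.ofReal (c * K₀ x)) x =
        (A.indicator fun y => ENNReal.ofReal (c * K₀ (ε⁻¹ • y))) (ε • x) := fun x => by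
      by_cases hx : ε • x ∈ A <;> simp [hx, smul_smul, inv_mul_cancel₀ hε.ne']
    have hm : Measurable (A.indicator fun y => ENNReal.ofReal (c * K₀ (ε⁻¹ • y))) := by
      refine Measurable.indicator ?_ hA
      have : Measurable K₀ := hK₀c.measurable
      fun_prop
    simp_rw [h1]
    rw [← lintegral_map hm hmeas, Measure.map_addHaar_smul vol hε.ne', lintegral_smul_measure,
      smul_eq_mul, ← lintegral_const_mul _ hm]
    refine lintegral_congr fun x => ?_
    by_cases hx : x ∈ A
    · simp only [hx, Set.indicator_of_mem]
      rw [← ENNReal.ofReal_mul ha0.le, mul_assoc]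
    · simp [hx]
end

/-! ### Mollified fields: Lipschitz bound and `L¹` comparison. -/

section
variable {E : Type*} [NormedAddCommGroup E] [MeasurableSpace E] [BorelSpace E]

namespace IsMollifier
variable {K : E → ℝ} {C M : ℝ} {b : E → E}

theorem integrable_sub (hK : IsMollifier K C M) (ρ : Measure E)
    [IsFiniteMeasure ρ] (x : E) : Integrable (fun z => K (x - z)) ρ := by
  refine Integrable.of_bound (C := M) ?_ (ae_of_all _ fun z => ?_)
  · exact (hK.continuous.comp (by fun_prop)).aestronglyMeasurable
  · rw [Real.norm_of_nonneg (hK.pos _).le]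
    exact hK.le _

theorem integral_sub_pos (hK : IsMollifier K C M) (ρ : Measure E)
    [IsFiniteMeasure ρ] [NeZero ρ] (x : E) : 0 < ∫ z, K (x - z) ∂ρ := by
  refine (integral_pos_iff_support_of_nonneg (fun z => (hK.pos _).le) (hK.integrable_sub ρ x)).2 ?_
  have : (Function.support fun z => K (x - z)) = Set.univ := by
    ext z
    simp [(hK.pos _).ne']
  rw [this]
  exact Measure.measure_univ_pos.2 (NeZero.ne ρ)

/-- The right side of the mollifier inequality is linear in `K`, so convolution with `ρ` preserves
it with the same constant. -/
theorem abs_integral_sub_sub_le (hK : IsMollifier K C M) (ρ : Measure E)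
    [IsFiniteMeasure ρ] (x y : E) :
    |∫ z, K (x - z) ∂ρ - ∫ z, K (y - z) ∂ρ| ≤
      C * ‖x - y‖ * (∫ z, K (x - z) ∂ρ + ∫ z, K (y - z) ∂ρ) := by
  rw [← integral_sub (hK.integrable_sub ρ x) (hK.integrable_sub ρ y),
    ← integral_add (hK.integrable_sub ρ x) (hK.integrable_sub ρ y), ← integral_const_mul]
  refine norm_integral_le_of_norm_le (f := fun z => K (x - z) - K (y - z))
    (((hK.integrable_sub ρ x).add (hK.integrable_sub ρ y)).const_mul _) (ae_of_all _ fun z => ?_)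
  simpa using hK.abs_sub_le (x - z) (y - z)

variable [NormedSpace ℝ E]

theorem norm_integral_sub_smul_le (hK : IsMollifier K C M) (ρ : Measure E)
    [IsFiniteMeasure ρ] (hb1 : ∀ x, ‖b x‖ ≤ 1) (x : E) :
    ‖∫ z, K (x - z) • b z ∂ρ‖ ≤ ∫ z, K (x - z) ∂ρ := by
  refine norm_integral_le_of_norm_le (hK.integrable_sub ρ x) (ae_of_all _ fun z => ?_)
  rw [norm_smul, Real.norm_of_nonneg (hK.pos _).le]
  exact mul_le_of_le_one_right (hK.pos _).le (hb1 z)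

/-- The quotient of the mollifications of `b ρ` and `ρ`. -/
noncomputable def _root_.mollifiedField (K : E → ℝ) (ρ : Measure E) (b : E → E) (x : E) : E :=
  (∫ z, K (x - z) ∂ρ)⁻¹ • ∫ z, K (x - z) • b z ∂ρ

theorem smul_mollifiedField (hK : IsMollifier K C M) (ρ : Measure E)
    [IsFiniteMeasure ρ] [NeZero ρ] (x : E) :
    (∫ z, K (x - z) ∂ρ) • mollifiedField K ρ b x = ∫ z, K (x - z) • b z ∂ρ := by
  rw [mollifiedField, smul_smul, mul_inv_cancel₀ (hK.integral_sub_pos ρ x).ne', one_smul]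

theorem norm_mollifiedField_le (hK : IsMollifier K C M) (ρ : Measure E)
    [IsFiniteMeasure ρ] (hb1 : ∀ x, ‖b x‖ ≤ 1) [NeZero ρ] (x : E) : ‖mollifiedField K ρ b x‖ ≤ 1 :=
        by
  have hr := hK.integral_sub_pos ρ x
  have h := hK.norm_integral_sub_smul_le ρ hb1 x
  rw [mollifiedField, norm_smul, norm_inv, Real.norm_of_nonneg hr.le]
  rwa [inv_mul_le_iff₀ hr, mul_one]

variable [FiniteDimensional ℝ E]

theorem integrable_sub_smul (hK : IsMollifier K C M) (ρ : Measure E)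
    [IsFiniteMeasure ρ] (hb : Measurable b) (hb1 : ∀ x, ‖b x‖ ≤ 1) (x : E) :
    Integrable (fun z => K (x - z) • b z) ρ := by
  refine Integrable.mono (hK.integrable_sub ρ x) ?_ (ae_of_all _ fun z => ?_)
  · exact (hK.integrable_sub ρ x).1.smul hb.aestronglyMeasurable
  · rw [norm_smul]
    exact mul_le_of_le_one_right (norm_nonneg _) (hb1 z)

theorem norm_integral_sub_smul_sub_le (hK : IsMollifier K C M) (ρ : Measure E)
    [IsFiniteMeasure ρ] (hb : Measurable b) (hb1 : ∀ x, ‖b x‖ ≤ 1) (x y : E) :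
    ‖∫ z, K (x - z) • b z ∂ρ - ∫ z, K (y - z) • b z ∂ρ‖ ≤
      C * ‖x - y‖ * (∫ z, K (x - z) ∂ρ + ∫ z, K (y - z) ∂ρ) := by
  rw [← integral_sub (hK.integrable_sub_smul ρ hb hb1 x) (hK.integrable_sub_smul ρ hb hb1 y),
    ← integral_add (hK.integrable_sub ρ x) (hK.integrable_sub ρ y), ← integral_const_mul]
  refine norm_integral_le_of_norm_le (((hK.integrable_sub ρ x).add
    (hK.integrable_sub ρ y)).const_mul _) (ae_of_all _ fun z => ?_)
  rw [← sub_smul, norm_smul]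
  refine (mul_le_of_le_one_right (norm_nonneg _) (hb1 z)).trans ?_
  simpa using hK.abs_sub_le (x - z) (y - z)

/-- The numerator `K * bρ`, rather than the quotient, is the field to which integration by parts is
applied later. -/
theorem exists_lipschitzWith_integral_sub_smul (hK : IsMollifier K C M) (ρ : Measure E)
    [IsFiniteMeasure ρ] (hb : Measurable b) (hb1 : ∀ x, ‖b x‖ ≤ 1) :
    ∃ L : ℝ≥0, LipschitzWith L fun x => ∫ z, K (x - z) • b z ∂ρ := by
  have hr : ∀ x, ∫ z, K (x - z) ∂ρ ≤ M * ρ.real Set.univ := fun x => by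
    have := integral_mono (hK.integrable_sub ρ x) (integrable_const M) fun z => hK.le (x - z)
    rwa [integral_const, smul_eq_mul, mul_comm] at this
  have hr0 : 0 ≤ M * ρ.real Set.univ := by
    have : 0 ≤ M := (hK.pos 0).le.trans (hK.le 0)
    positivity
  refine ⟨(C * (2 * (M * ρ.real Set.univ))).toNNReal,
    LipschitzWith.of_dist_le_mul fun x y => ?_⟩
  rw [dist_eq_norm, dist_eq_norm]
  refine (hK.norm_integral_sub_smul_sub_le ρ hb hb1 x y).trans ?_
  have h1 : 0 ≤ C * ‖x - y‖ := mul_nonneg hK.C_nonneg (norm_nonneg _)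
  calc _ ≤ C * ‖x - y‖ * (2 * (M * ρ.real Set.univ)) := by
        refine mul_le_mul_of_nonneg_left ?_ h1
        linarith [hr x, hr y]
    _ = _ := by
        rw [Real.coe_toNNReal _ (mul_nonneg hK.C_nonneg (by positivity))]; ring

/-- With `r = K * ρ` and `r x ≥ r y`, split `r x (V x - V y)` into `(r x V x - r y V y) + (r y - r
x) V y`. Each term is at most `C ‖x - y‖ (r x + r y) ≤ 2 C ‖x - y‖ r x`, and `r x` cancels. This is
why increments of `K` must be controlled by its values: no lower bound on `r` is available. -/
theorem lipschitzWith_mollifiedField (hK : IsMollifier K C M) (ρ : Measure E)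
    [IsFiniteMeasure ρ] (hb : Measurable b) (hb1 : ∀ x, ‖b x‖ ≤ 1) [NeZero ρ] :
    LipschitzWith (4 * C).toNNReal (mollifiedField K ρ b) := by
  refine LipschitzWith.of_dist_le_mul fun x y => ?_
  rw [dist_eq_norm, dist_eq_norm, Real.coe_toNNReal _ (mul_nonneg (by norm_num) hK.C_nonneg)]
  wlog hxy : ∫ z, K (y - z) ∂ρ ≤ ∫ z, K (x - z) ∂ρ generalizing x y
  · rw [norm_sub_rev, norm_sub_rev x]
    exact this y x (le_of_not_ge hxy)
  set V := mollifiedField K ρ b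
  have hrx := hK.integral_sub_pos ρ x
  have h1 := hK.abs_integral_sub_sub_le ρ x y
  have h2 := hK.norm_integral_sub_smul_sub_le ρ hb hb1 x y
  rw [← hK.smul_mollifiedField ρ x, ← hK.smul_mollifiedField ρ y] at h2
  set rx := ∫ z, K (x - z) ∂ρ
  set ry := ∫ z, K (y - z) ∂ρ
  have h3 : rx • (V x - V y) = (rx • V x - ry • V y) + (ry - rx) • V y := by
    module
  have h4 : rx * ‖V x - V y‖ ≤ rx * (4 * C * ‖x - y‖) := by
    calc rx * ‖V x - V y‖ = ‖rx • (V x - V y)‖ := by rw [norm_smul, Real.norm_of_nonneg hrx.le]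
      _ ≤ C * ‖x - y‖ * (rx + ry) + C * ‖x - y‖ * (rx + ry) := by
        rw [h3]
        refine (norm_add_le _ _).trans (add_le_add h2 ?_)
        rw [norm_smul, Real.norm_eq_abs, abs_sub_comm]
        exact (mul_le_of_le_one_right (abs_nonneg _) (hK.norm_mollifiedField_le ρ hb1 y)).trans h1
      _ ≤ C * ‖x - y‖ * (rx + rx) + C * ‖x - y‖ * (rx + rx) := by
        have : 0 ≤ C * ‖x - y‖ := mul_nonneg hK.C_nonneg (norm_nonneg _)
        gcongr
      _ = _ := by ring
  exact le_of_mul_le_mul_left h4 hrx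

theorem conv_withDensity (hK : IsMollifier K C M) (ρ : Measure E)
    [IsFiniteMeasure ρ] (vol : Measure E) [vol.IsAddHaarMeasure] :
    ρ.conv (vol.withDensity fun x => ENNReal.ofReal (K x)) =
      vol.withDensity fun x => ENNReal.ofReal (∫ z, K (x - z) ∂ρ) := by
  have hKm : Measurable K := hK.continuous.measurable
  ext A hA
  rw [Measure.conv, Measure.map_apply measurable_add hA,
    Measure.prod_apply (measurable_add hA), withDensity_apply _ hA]
  have h1 : ∀ z, (vol.withDensity fun x => ENNReal.ofReal (K x))
      (Prod.mk z ⁻¹' ((fun p : E × E => p.1 + p.2) ⁻¹' A)) =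
      ∫⁻ x in A, ENNReal.ofReal (K (x - z)) ∂vol := fun z => by
    have hA' : MeasurableSet ((fun y : E => z + y) ⁻¹' A) := measurable_const_add z hA
    change (vol.withDensity fun x => ENNReal.ofReal (K x)) ((fun y : E => z + y) ⁻¹' A) = _
    rw [withDensity_apply _ hA', ← lintegral_indicator hA', ← lintegral_indicator hA,
      ← lintegral_add_left_eq_self (A.indicator fun x => ENNReal.ofReal (K (x - z))) z]
    refine lintegral_congr fun y => ?_
    by_cases hy : z + y ∈ A <;> simp [hy]
  simp_rw [h1]
  rw [lintegral_lintegral_swap (f := fun z x => ENNReal.ofReal (K (x - z)))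
    (Measurable.aemeasurable (by fun_prop))]
  refine lintegral_congr fun x => ?_
  rw [ofReal_integral_eq_lintegral_ofReal (hK.integrable_sub ρ x)
    (ae_of_all _ fun z => (hK.pos _).le)]

/-- Multiplied by the density `K * ρ`, the difference `V - c` at `x` is the average of `b z - c x`
with weight `K (x - z)`. The bound follows by Tonelli and `x = z + y`. It replaces any pointwise
convergence of `V` to `b`. -/
theorem lintegral_enorm_mollifiedField_sub_le (hK : IsMollifier K C M) (ρ : Measure E)
    [IsFiniteMeasure ρ] (hb : Measurable b) (hb1 : ∀ x, ‖b x‖ ≤ 1) [NeZero ρ]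
    (vol : Measure E) [vol.IsAddHaarMeasure] {c : E → E} (hc : Measurable c) :
    ∫⁻ x, ‖mollifiedField K ρ b x - c x‖ₑ
        ∂(ρ.conv (vol.withDensity fun x => ENNReal.ofReal (K x))) ≤
      ∫⁻ z, ∫⁻ y, ‖b z - c (z + y)‖ₑ ∂(vol.withDensity fun x => ENNReal.ofReal (K x)) ∂ρ := by
  have hKm : Measurable K := hK.continuous.measurable
  have hrm : Measurable fun x => ∫ z, K (x - z) ∂ρ := by
    refine StronglyMeasurable.measurable ?_
    refine StronglyMeasurable.integral_prod_right (f := fun x z => K (x - z)) ?_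
    exact (hK.continuous.comp (by fun_prop)).stronglyMeasurable
  have hVm := (hK.lipschitzWith_mollifiedField ρ hb hb1).continuous.measurable
  rw [hK.conv_withDensity ρ vol, lintegral_withDensity_eq_lintegral_mul _ (by fun_prop)
      (by fun_prop)]
  have h1 : ∀ x, ENNReal.ofReal (∫ z, K (x - z) ∂ρ) * ‖mollifiedField K ρ b x - c x‖ₑ ≤
      ∫⁻ z, ENNReal.ofReal (K (x - z)) * ‖b z - c x‖ₑ ∂ρ := fun x => by
    have hr := hK.integral_sub_pos ρ x
    have e1 : (∫ z, K (x - z) ∂ρ) • (mollifiedField K ρ b x - c x) =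
        ∫ z, K (x - z) • (b z - c x) ∂ρ := by
      simp_rw [smul_sub]
      rw [hK.smul_mollifiedField, integral_sub (hK.integrable_sub_smul ρ hb hb1 x)
        ((hK.integrable_sub ρ x).smul_const _), integral_smul_const]
    calc _ = ‖(∫ z, K (x - z) ∂ρ) • (mollifiedField K ρ b x - c x)‖ₑ := by
          rw [enorm_smul, Real.enorm_eq_ofReal hr.le]
      _ ≤ _ := by
          rw [e1]
          refine (enorm_integral_le_lintegral_enorm _).trans (le_of_eq ?_)
          refine lintegral_congr fun z => ?_
          rw [enorm_smul, Real.enorm_eq_ofReal (hK.pos _).le]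
  refine (lintegral_mono h1).trans (le_of_eq ?_)
  rw [lintegral_lintegral_swap (f := fun x z => ENNReal.ofReal (K (x - z)) * ‖b z - c x‖ₑ)
    (Measurable.aemeasurable (by fun_prop))]
  refine lintegral_congr fun z => ?_
  rw [lintegral_withDensity_eq_lintegral_mul _ (by fun_prop) (by fun_prop),
    ← lintegral_add_left_eq_self (fun x => ENNReal.ofReal (K (x - z)) * ‖b z - c x‖ₑ) z]
  refine lintegral_congr fun y => ?_
  simp

end IsMollifier
end

/-! ### Divergence free fields tested with Lipschitz functions. -/

section
variable {E : Type*} [NormedAddCommGroup E] [NormedSpace ℝ E] [FiniteDimensional ℝ E]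
  [MeasurableSpace E] [BorelSpace E]

/-- For a Lipschitz field, vanishing distributional divergence can be tested with Lipschitz
functions. -/
theorem LipschitzWith.integral_fderiv_apply_eq_zero {vol : Measure E} [vol.IsAddHaarMeasure]
    {m : E → E} {L : ℝ≥0} (hm : LipschitzWith L m)
    (hdiv : ∀ ψ : E → ℝ, ContDiff ℝ ∞ ψ → HasCompactSupport ψ → ∫ x, fderiv ℝ ψ x (m x) ∂vol = 0)
    {u : E → ℝ} {D : ℝ≥0} (hu : LipschitzWith D u) (hu' : HasCompactSupport u) :
    ∫ x, fderiv ℝ u x (m x) ∂vol = 0 := by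
  let e := Module.finBasis ℝ E
  let f : Fin (Module.finrank ℝ E) → E → ℝ := fun i x => e.coord i (m x)
  have hf : ∀ i, ∃ C : ℝ≥0, LipschitzWith C (f i) := fun i =>
    ⟨_, (LinearMap.toContinuousLinearMap (e.coord i)).lipschitz.comp hm⟩
  choose C hC using hf
  -- The almost everywhere divergence of `m`. Integration by parts for Lipschitz functions
  -- identifies it with the distributional one, so smooth tests already force `w = 0` almost
  -- everywhere.
  let w : E → ℝ := fun x => ∑ i, lineDeriv ℝ (f i) x (e i)
  have key : ∀ (v : E → ℝ) (D : ℝ≥0), LipschitzWith D v → HasCompactSupport v →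
      ∫ x, fderiv ℝ v x (m x) ∂vol = - ∫ x, v x * w x ∂vol := by
    intro v D hv hv'
    have h1 : ∀ᵐ x ∂vol, fderiv ℝ v x (m x) = ∑ i, lineDeriv ℝ v x (e i) * f i x := by
      filter_upwards [hv.ae_differentiableAt] with x hx
      conv_lhs => rw [← e.sum_repr (m x), map_sum]
      refine Finset.sum_congr rfl fun i _ => ?_
      rw [map_smul, hx.lineDeriv_eq_fderiv, smul_eq_mul, mul_comm]
      rfl
    have hvi : Integrable v vol := hv.continuous.integrable_of_hasCompactSupport hv'
    have hsupp : ∀ i, HasCompactSupport fun x => lineDeriv ℝ v x (e i) := fun i => by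
      refine HasCompactSupport.intro' hv' (isClosed_tsupport v) fun x hx => ?_
      have : v =ᶠ[nhds x] 0 := notMem_tsupport_iff_eventuallyEq.1 hx
      rw [this.lineDeriv_eq]
      simp [lineDeriv]
    have hi : ∀ i, Integrable (fun x => lineDeriv ℝ v x (e i) * f i x) vol := fun i => by
      have h3 := (((hv.locallyIntegrable_lineDeriv (μ := vol) (e i)).integrableOn_isCompact
        (hsupp i)).mul_continuousOn (hC i).continuous.continuousOn (hsupp i))
      refine (integrableOn_iff_integrable_of_support_subset fun x hx => ?_).1 h3
      exact subset_tsupport _ (left_ne_zero_of_mul hx)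
    have hi' : ∀ i, Integrable (fun x => v x * lineDeriv ℝ (f i) x (e i)) vol := fun i => by
      refine hvi.mul_bdd (c := C i * ‖e i‖) (aestronglyMeasurable_lineDeriv (hC i).continuous vol)
        (ae_of_all _ fun x => norm_lineDeriv_le_of_lipschitz ℝ (hC i))
    rw [integral_congr_ae h1, integral_finsetSum _ fun i _ => hi i]
    simp only [w, Finset.mul_sum]
    rw [integral_finsetSum _ fun i _ => hi' i, ← Finset.sum_neg_distrib]
    refine Finset.sum_congr rfl fun i _ => ?_
    have := integral_lineDeriv_mul_eq (μ := vol) (hC i) hv hv' (e i)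
    simp only [lineDeriv_neg] at this
    simp only [neg_mul] at this
    rw [integral_neg] at this
    simp_rw [mul_comm (v _)]
    rw [this, neg_neg]
  have hw : ∀ᵐ x ∂vol, w x = 0 := by
    refine ae_eq_zero_of_integral_contDiff_smul_eq_zero ?_ fun g hg hg' => ?_
    · exact locallyIntegrable_finsetSum _ fun i _ => (hC i).locallyIntegrable_lineDeriv (e i)
    · obtain ⟨D, hD⟩ := ContDiff.lipschitzWith_of_hasCompactSupport hg' hg (by simp)
      have := key g D hD hg'
      rw [hdiv g hg hg'] at this
      simpa using this.symm
  rw [key u D hu hu', neg_eq_zero]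
  exact integral_eq_zero_of_ae (hw.mono fun x hx => by simp [hx])

namespace IsMollifier
variable {K : E → ℝ} {C M : ℝ} {b : E → E}

/-- Fubini and a translation move the convolution onto `ψ`; for fixed `x` the inner integral is the
hypothesis tested with `ψ (x + ·)`. -/
theorem integral_fderiv_integral_sub_smul (hK : IsMollifier K C M) (ρ : Measure E)
    [IsFiniteMeasure ρ] (hb : Measurable b) (hb1 : ∀ x, ‖b x‖ ≤ 1) {vol : Measure E}
    [vol.IsAddHaarMeasure] (hKi : Integrable K vol)
    (hdiv : ∀ ψ : E → ℝ, ContDiff ℝ ∞ ψ → HasCompactSupport ψ → ∫ x, fderiv ℝ ψ x (b x) ∂ρ = 0)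
    {ψ : E → ℝ} (hψ : ContDiff ℝ ∞ ψ) (hψ' : HasCompactSupport ψ) :
    ∫ x, fderiv ℝ ψ x (∫ z, K (x - z) • b z ∂ρ) ∂vol = 0 := by
  have hKm : Measurable K := hK.continuous.measurable
  have hdc : Continuous (fderiv ℝ ψ) := hψ.continuous_fderiv (by simp)
  have hds : HasCompactSupport (fderiv ℝ ψ) := hψ'.fderiv ℝ
  obtain ⟨A, hA⟩ := hdc.bounded_above_of_compact_support hds
  have hmeas : ∀ g : E × E → E, Measurable g →
      Measurable fun p : E × E => fderiv ℝ ψ (g p) (b p.2) := fun g hg => by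
    have h1 : Measurable fun p : E × E => fderiv ℝ ψ (g p) := hdc.measurable.comp hg
    have h2 : Measurable fun p : E × E => b p.2 := by fun_prop
    exact (isBoundedBilinearMap_apply (𝕜 := ℝ) (E := E) (F := ℝ)).continuous.measurable.comp
      (h1.prodMk h2)
  have hint : Integrable (fun p : E × E => K (p.1 - p.2) * fderiv ℝ ψ p.1 (b p.2))
      (vol.prod ρ) := by
    have h1 : Integrable (fun p : E × E => M * ‖fderiv ℝ ψ p.1‖) (vol.prod ρ) :=
      (((hdc.integrable_of_hasCompactSupport hds).norm.const_mul M).comp_fst ρ)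
    refine h1.mono' ?_ (ae_of_all _ fun p => ?_)
    · have := hmeas Prod.fst measurable_fst
      exact Measurable.aestronglyMeasurable (by fun_prop)
    · rw [norm_mul, Real.norm_of_nonneg (hK.pos _).le]
      refine mul_le_mul (hK.le _) ?_ (norm_nonneg _) ((hK.pos 0).le.trans (hK.le 0))
      exact (ContinuousLinearMap.le_opNorm _ _).trans
        (mul_le_of_le_one_right (norm_nonneg _) (hb1 _))
  -- After the translation the derivative of `ψ` no longer gives decay in the first variable;
  -- integrability now comes from `K`.
  have hint' : Integrable (fun p : E × E => K p.1 * fderiv ℝ ψ (p.1 + p.2) (b p.2))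
      (vol.prod ρ) := by
    have h1 : Integrable (fun p : E × E => K p.1 * A) (vol.prod ρ) :=
      (hKi.mul_const A).comp_fst ρ
    refine h1.mono' ?_ (ae_of_all _ fun p => ?_)
    · have := hmeas (fun p => p.1 + p.2) (by fun_prop)
      exact Measurable.aestronglyMeasurable (by fun_prop)
    · rw [norm_mul, Real.norm_of_nonneg (hK.pos _).le]
      refine mul_le_mul_of_nonneg_left ?_ (hK.pos _).le
      exact ((ContinuousLinearMap.le_opNorm _ _).trans
        (mul_le_of_le_one_right (norm_nonneg _) (hb1 _))).trans (hA _)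
  calc ∫ x, fderiv ℝ ψ x (∫ z, K (x - z) • b z ∂ρ) ∂vol
      = ∫ x, ∫ z, K (x - z) * fderiv ℝ ψ x (b z) ∂ρ ∂vol := by
        refine integral_congr_ae (ae_of_all _ fun x => ?_)
        dsimp only
        rw [← (fderiv ℝ ψ x).integral_comp_comm (hK.integrable_sub_smul ρ hb hb1 x)]
        simp
    _ = ∫ z, ∫ x, K (x - z) * fderiv ℝ ψ x (b z) ∂vol ∂ρ := integral_integral_swap hint
    _ = ∫ z, ∫ x, K x * fderiv ℝ ψ (x + z) (b z) ∂vol ∂ρ := by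
        refine integral_congr_ae (ae_of_all _ fun z => ?_)
        dsimp only
        rw [← integral_add_right_eq_self (fun x => K (x - z) * fderiv ℝ ψ x (b z)) z]
        simp
    _ = ∫ x, ∫ z, K x * fderiv ℝ ψ (x + z) (b z) ∂ρ ∂vol := (integral_integral_swap hint').symm
    _ = 0 := by
        refine integral_eq_zero_of_ae (ae_of_all _ fun x => ?_)
        have h1 := hdiv (fun z => ψ (x + z)) (by fun_prop)
          (hψ'.comp_homeomorph (Homeomorph.addLeft x))
        simp only [fderiv_comp_add_left] at h1
        simp [integral_const_mul, h1]

theorem integral_fderiv_mollifiedField (hK : IsMollifier K C M) (ρ : Measure E)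
    [IsFiniteMeasure ρ] [NeZero ρ] (hb : Measurable b) (hb1 : ∀ x, ‖b x‖ ≤ 1) {vol : Measure E}
    [vol.IsAddHaarMeasure] (hKi : Integrable K vol)
    (hdiv : ∀ ψ : E → ℝ, ContDiff ℝ ∞ ψ → HasCompactSupport ψ → ∫ x, fderiv ℝ ψ x (b x) ∂ρ = 0)
    {u : E → ℝ} {D : ℝ≥0} (hu : LipschitzWith D u) (hu' : HasCompactSupport u) :
    ∫ x, fderiv ℝ u x (mollifiedField K ρ b x)
      ∂(ρ.conv (vol.withDensity fun x => ENNReal.ofReal (K x))) = 0 := by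
  obtain ⟨L, hL⟩ := hK.exists_lipschitzWith_integral_sub_smul ρ hb hb1
  have hrm : Measurable fun x => ∫ z, K (x - z) ∂ρ := by
    refine StronglyMeasurable.measurable ?_
    refine StronglyMeasurable.integral_prod_right (f := fun x z => K (x - z)) ?_
    exact (hK.continuous.comp (by fun_prop)).stronglyMeasurable
  rw [hK.conv_withDensity ρ vol, integral_withDensity_eq_integral_toReal_smul (by fun_prop)
    (ae_of_all _ fun x => ENNReal.ofReal_lt_top)]
  rw [← LipschitzWith.integral_fderiv_apply_eq_zero hL (vol := vol)
    (fun ψ h h' => hK.integral_fderiv_integral_sub_smul ρ hb hb1 hKi hdiv h h') hu hu']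
  refine integral_congr_ae (ae_of_all _ fun x => ?_)
  dsimp only
  rw [← hK.smul_mollifiedField ρ x, map_smul, ENNReal.toReal_ofReal (hK.integral_sub_pos ρ x).le]
end IsMollifier

/-- A finite measure `ρ` with a divergence free unit field is approximated by measures which
carry divergence free bounded Lipschitz fields. -/
theorem exists_mollification (ρ : Measure E) [IsFiniteMeasure ρ] [NeZero ρ] {b : E → E}
    (hb : Measurable b) (hb1 : ∀ x, ‖b x‖ ≤ 1)
    (hdiv : ∀ ψ : E → ℝ, ContDiff ℝ ∞ ψ → HasCompactSupport ψ → ∫ x, fderiv ℝ ψ x (b x) ∂ρ = 0) :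
    ∃ κ : Measure E, IsProbabilityMeasure κ ∧ ∀ ε : ℝ, 0 < ε → ∃ (V : E → E) (L : ℝ≥0),
      LipschitzWith L V ∧ (∀ x, ‖V x‖ ≤ 1) ∧
      ρ.conv (κ.map fun x => ε • x) ≪ Measure.addHaar ∧
      (∀ (u : E → ℝ) (D : ℝ≥0), LipschitzWith D u → HasCompactSupport u →
        ∫ x, fderiv ℝ u x (V x) ∂(ρ.conv (κ.map fun x => ε • x)) = 0) ∧
      ∀ c : E → E, Measurable c → ∫⁻ x, ‖V x - c x‖ₑ ∂(ρ.conv (κ.map fun x => ε • x)) ≤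
        ∫⁻ z, ∫⁻ y, ‖b z - c (z + ε • y)‖ₑ ∂κ ∂ρ := by
  obtain ⟨κ, hκ, h⟩ := exists_mollifier_measure (Measure.addHaar : Measure E)
  refine ⟨κ, hκ, fun ε hε => ?_⟩
  obtain ⟨K, C, M, hK, hmap⟩ := h ε hε
  have hmeas : Measurable fun x : E => ε • x := measurable_const_smul ε
  have hKi : Integrable K (Measure.addHaar : Measure E) := by
    refine ⟨hK.continuous.aestronglyMeasurable, ?_⟩
    rw [hasFiniteIntegral_iff_ofReal (ae_of_all _ fun x => (hK.pos x).le)]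
    have := Measure.isProbabilityMeasure_map (μ := κ) hmeas.aemeasurable
    have h1 := measure_lt_top (κ.map fun x => ε • x) Set.univ
    rwa [hmap, withDensity_apply _ MeasurableSet.univ, Measure.restrict_univ] at h1
  refine ⟨mollifiedField K ρ b, _, hK.lipschitzWith_mollifiedField ρ hb hb1,
    hK.norm_mollifiedField_le ρ hb1, ?_, ?_, ?_⟩
  · rw [hmap, hK.conv_withDensity]
    exact withDensity_absolutelyContinuous _ _
  · intro u D hu hu'
    rw [hmap]
    exact hK.integral_fderiv_mollifiedField ρ hb hb1 hKi hdiv hu hu'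
  · intro c hc
    have h1 := hK.lintegral_enorm_mollifiedField_sub_le ρ hb hb1 Measure.addHaar hc
    rw [← hmap] at h1
    refine h1.trans (le_of_eq (lintegral_congr fun z => ?_))
    rw [lintegral_map (by fun_prop) hmeas]
end

/-! ### Flows of Lipschitz fields and their invariant measures. -/

section
variable {E : Type*} [NormedAddCommGroup E] [NormedSpace ℝ E] [CompleteSpace E]

/-- The flow of a bounded Lipschitz field on a finite time interval. -/
theorem LipschitzWith.exists_flow {V : E → E} {L : ℝ≥0} (hV : LipschitzWith L V)
    (hV1 : ∀ x, ‖V x‖ ≤ 1) {ℓ : ℝ} (hℓ : 0 ≤ ℓ) :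
    ∃ X : ℝ → E → E, (∀ x, X 0 x = x) ∧
      (∀ t ∈ Set.Icc 0 ℓ, ∀ x, HasDerivAt (fun s => X s x) (V (X t x)) t) ∧
      (∀ s t x, 0 ≤ s → 0 ≤ t → s + t ≤ ℓ → X (s + t) x = X t (X s x)) ∧
      ∃ A : ℝ≥0, ∀ t ∈ Set.Icc 0 ℓ, LipschitzWith A (X t) := by
  -- The margin of length 1 makes derivatives at the times `0` and `ℓ` two-sided.
  have hT : (0 : ℝ) ∈ Set.Icc (-(ℓ + 1)) (ℓ + 1) := ⟨by linarith, by linarith⟩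
  have hex : ∀ x : E, ∃ α : ℝ → E, α 0 = x ∧
      ∀ t ∈ Set.Icc (-(ℓ + 1)) (ℓ + 1), HasDerivWithinAt α (V (α t))
          (Set.Icc (-(ℓ + 1)) (ℓ + 1)) t := by
    intro x
    -- At speed at most 1 a solution stays within distance `ℓ + 1` of its start, so a single
    -- application covers the whole interval.
    have hPL : IsPicardLindelof (fun _ : ℝ => V) (tmin := -(ℓ + 1)) (tmax := ℓ + 1) ⟨0, hT⟩ x
        (ℓ + 1).toNNReal 0 1 L :=
      { lipschitzOnWith := fun t _ => hV.lipschitzOnWith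
        continuousOn := fun y _ => continuousOn_const
        norm_le := fun t _ y _ => by simpa using hV1 y
        mul_max_le := by
          rw [Real.coe_toNNReal _ (by linarith)]
          simp }
    exact hPL.exists_eq_forall_mem_Icc_hasDerivWithinAt₀
  choose α hα0 hα using hex
  have hd : ∀ x, ∀ t ∈ Set.Icc 0 ℓ, HasDerivAt (α x) (V (α x t)) t := fun x t ht =>
    (hα x t ⟨by linarith [ht.1], by linarith [ht.2]⟩).hasDerivAt
      (Icc_mem_nhds (by linarith [ht.1]) (by linarith [ht.2]))
  have hc : ∀ x, ContinuousOn (α x) (Set.Icc 0 ℓ) := fun x t ht =>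
    (hd x t ht).continuousAt.continuousWithinAt
  refine ⟨fun t x => α x t, hα0, fun t ht x => hd x t ht, ?_, (Real.exp (L * ℓ)).toNNReal, ?_⟩
  · intro s t x hs ht hst
    have hsub : ∀ r ∈ Set.Icc 0 t, s + r ∈ Set.Icc 0 ℓ := fun r hr =>
      ⟨by linarith [hr.1], by linarith [hr.2]⟩
    have hsub' : ∀ r ∈ Set.Icc 0 t, r ∈ Set.Icc 0 ℓ := fun r hr =>
      ⟨hr.1, by linarith [hr.2]⟩
    have h1 : ∀ r ∈ Set.Icc 0 t, HasDerivAt (fun r => α x (s + r)) (V (α x (s + r))) r :=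
      fun r hr => (hd x (s + r) (hsub r hr)).comp_const_add s r
    have h := ODE_solution_unique (v := fun _ => V) (K := L) (f := fun r => α x (s + r))
      (g := α (α x s)) (a := 0) (b := t) (fun _ => hV)
      (fun r hr => (h1 r hr).continuousAt.continuousWithinAt)
      (fun r hr => (h1 r (Set.Ico_subset_Icc_self hr)).hasDerivWithinAt)
      (fun r hr => (hd _ r (hsub' r hr)).continuousAt.continuousWithinAt)
      (fun r hr => (hd _ r (hsub' r (Set.Ico_subset_Icc_self hr))).hasDerivWithinAt)
      (by simp [hα0])
    exact h ⟨ht, le_rfl⟩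
  · intro t ht
    refine LipschitzWith.of_dist_le_mul fun x y => ?_
    have h := dist_le_of_trajectories_ODE (v := fun _ => V) (K := L) (f := α x) (g := α y)
      (a := 0) (b := ℓ) (δ := dist x y) (fun _ => hV) (hc x)
      (fun r hr => (hd x r (Set.Ico_subset_Icc_self hr)).hasDerivWithinAt) (hc y)
      (fun r hr => (hd y r (Set.Ico_subset_Icc_self hr)).hasDerivWithinAt) (by simp [hα0]) t ht
    rw [Real.coe_toNNReal _ (Real.exp_pos _).le, mul_comm]
    refine h.trans (mul_le_mul_of_nonneg_left (Real.exp_le_exp.2 ?_) dist_nonneg)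
    have := ht.2
    gcongr
    linarith
end

section
variable {E : Type*} [NormedAddCommGroup E] [NormedSpace ℝ E]

theorem norm_sub_le_of_flow {V : E → E} (hV1 : ∀ x, ‖V x‖ ≤ 1) {ℓ : ℝ} {X : ℝ → E → E}
    (hX : ∀ t ∈ Set.Icc 0 ℓ, ∀ x, HasDerivAt (fun s => X s x) (V (X t x)) t) {s t : ℝ}
    (hs : s ∈ Set.Icc 0 ℓ) (ht : t ∈ Set.Icc 0 ℓ) (x : E) : ‖X t x - X s x‖ ≤ |t - s| := by
  have := (convex_Icc (0 : ℝ) ℓ).norm_image_sub_le_of_norm_hasDerivWithin_le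
    (f := fun s => X s x) (C := 1) (fun t ht => (hX t ht x).hasDerivWithinAt)
        (fun t _ => hV1 _) hs ht
  simpa using this

end

section
variable {E : Type*} [NormedAddCommGroup E] [NormedSpace ℝ E] [FiniteDimensional ℝ E]
  [MeasurableSpace E] [BorelSpace E]

/-- Thickened indicators of a compact set are Lipschitz with compact support and converge to its
indicator; inner regularity extends equality from compact to Borel sets. -/
theorem Measure.ext_of_integral_lipschitz_compactSupport {σ τ : Measure E} [IsFiniteMeasure σ]
    [IsFiniteMeasure τ] (h : ∀ (u : E → ℝ) (D : ℝ≥0), LipschitzWith D u → HasCompactSupport u →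
      ∫ x, u x ∂σ = ∫ x, u x ∂τ) : σ = τ := by
  have hK : ∀ F : Set E, IsCompact F → σ F = τ F := by
    intro F hF
    have hδ : ∀ k : ℕ, (0 : ℝ) < 1 / ((k : ℝ) + 1) := fun k => by positivity
    have hlim := tendsto_one_div_add_atTop_nhds_zero_nat (𝕜 := ℝ)
    have h1 := tendsto_lintegral_thickenedIndicator_of_isClosed σ hF.isClosed hδ hlim
    have h2 := tendsto_lintegral_thickenedIndicator_of_isClosed τ hF.isClosed hδ hlim
    refine tendsto_nhds_unique h1 (h2.congr fun k => ?_)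
    have hcs : HasCompactSupport fun x => (thickenedIndicator (hδ k) F x : ℝ) := by
      refine HasCompactSupport.intro (hF.cthickening (r := 1 / ((k : ℝ) + 1))) fun x hx => ?_
      have hx' : x ∉ Metric.thickening (1 / ((k : ℝ) + 1)) F := fun h' =>
        hx (Metric.thickening_subset_cthickening _ _ h')
      rw [thickenedIndicator_zero (hδ k) F hx', NNReal.coe_zero]
    have h3 := h (fun x => (thickenedIndicator (hδ k) F x : ℝ)) _
      (lipschitzWith_thickenedIndicator (hδ k) F) hcs
    have h4 : ∀ (ν : Measure E) [IsFiniteMeasure ν],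
        ∫⁻ x, (thickenedIndicator (hδ k) F x : ℝ≥0∞) ∂ν =
          ENNReal.ofReal (∫ x, (thickenedIndicator (hδ k) F x : ℝ) ∂ν) := fun ν _ => by
      rw [ofReal_integral_eq_lintegral_ofReal ?_ (ae_of_all _ fun x => NNReal.coe_nonneg _)]
      · simp
      · refine Integrable.of_bound (C := 1) ?_ (ae_of_all _ fun x => ?_)
        · exact (NNReal.continuous_coe.comp
            (thickenedIndicator (hδ k) F).continuous).aestronglyMeasurable
        · rw [Real.norm_of_nonneg (NNReal.coe_nonneg _)]
          exact_mod_cast thickenedIndicator_le_one (hδ k) F x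
    rw [h4, h4, h3]
  ext A hA
  rw [hA.measure_eq_iSup_isCompact_of_ne_top (measure_ne_top σ A),
    hA.measure_eq_iSup_isCompact_of_ne_top (measure_ne_top τ A)]
  refine iSup_congr fun F => iSup_congr fun _ => iSup_congr fun hF => hK F hF

/-- The integral of `ψ ∘ X t` has right derivative zero in `t`. Writing `X (t + h) = X t ∘ X h`
makes this derivative the integral of `D(ψ ∘ X t) V`, that is, the divergence tested with `ψ ∘ X t`.
That function is only Lipschitz, which is why Lipschitz tests are required. -/
theorem map_flow_eq {V : E → E} (hV1 : ∀ x, ‖V x‖ ≤ 1) {ℓ : ℝ} {X : ℝ → E → E}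
    (hX0 : ∀ x, X 0 x = x)
    (hX : ∀ t ∈ Set.Icc 0 ℓ, ∀ x, HasDerivAt (fun s => X s x) (V (X t x)) t)
    (hXadd : ∀ s t x, 0 ≤ s → 0 ≤ t → s + t ≤ ℓ → X (s + t) x = X t (X s x)) {A : ℝ≥0}
    (hXL : ∀ t ∈ Set.Icc 0 ℓ, LipschitzWith A (X t)) {σ : Measure E} [IsFiniteMeasure σ]
    (hσ : σ ≪ Measure.addHaar)
    (hdiv : ∀ (u : E → ℝ) (D : ℝ≥0), LipschitzWith D u → HasCompactSupport u →
        ∫ x, fderiv ℝ u x (V x) ∂σ = 0) {t : ℝ} (ht : t ∈ Set.Icc 0 ℓ) : σ.map (X t) = σ := by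
  refine Measure.ext_of_integral_lipschitz_compactSupport fun ψ D hψ hψ' => ?_
  rw [integral_map (hXL t ht).continuous.aemeasurable hψ.continuous.aestronglyMeasurable]
  obtain ⟨B, hB⟩ := hψ.continuous.bounded_above_of_compact_support hψ'
  have hcont : ContinuousOn (fun t => ∫ x, ψ (X t x) ∂σ) (Set.Icc 0 ℓ) := by
    refine continuousOn_of_dominated (bound := fun _ => B) (fun t ht =>
      (hψ.continuous.comp (hXL t ht).continuous).aestronglyMeasurable)
      (fun t _ => ae_of_all _ fun x => hB _) (integrable_const _)
      (ae_of_all _ fun x => fun t ht => ?_)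
    exact hψ.continuous.continuousAt.comp_continuousWithinAt
      (hX t ht x).continuousAt.continuousWithinAt
  have hderiv : ∀ t ∈ Set.Ico 0 ℓ,
      HasDerivWithinAt (fun t => ∫ x, ψ (X t x) ∂σ) 0 (Set.Ici t) t := by
    intro t ht
    have ht' := Set.Ico_subset_Icc_self ht
    have hu : LipschitzWith (D * A) fun x => ψ (X t x) := hψ.comp (hXL t ht')
    -- The flow moves points by at most `ℓ`, so the support grows by at most `ℓ`.
    have hu' : HasCompactSupport fun x => ψ (X t x) := by
      obtain ⟨R, hR⟩ := hψ'.isCompact.isBounded.subset_closedBall 0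
      refine HasCompactSupport.intro (isCompact_closedBall (0 : E) (R + ℓ)) fun x hx => ?_
      by_contra hne
      have h1 := hR (subset_tsupport _ hne)
      have h2 := norm_sub_le_of_flow hV1 hX (s := 0) (t := t) ⟨le_rfl, ht'.1.trans ht'.2⟩ ht' x
      rw [hX0, sub_zero, abs_of_nonneg ht.1] at h2
      rw [mem_closedBall_zero_iff] at h1 hx
      have h3 := norm_sub_norm_le x (X t x)
      rw [norm_sub_rev] at h3
      linarith [ht.2]
    rw [← hasDerivWithinAt_Ioi_iff_Ici, hasDerivWithinAt_iff_tendsto_slope' (by simp)]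
    have hlim : Filter.Tendsto (fun s => ∫ x, s⁻¹ * (ψ (X t (X s x)) - ψ (X t x)) ∂σ)
        (nhdsWithin 0 (Set.Ioi 0)) (nhds (∫ x, fderiv ℝ (fun x => ψ (X t x)) x (V x) ∂σ)) := by
      have hev : ∀ᶠ s in nhdsWithin (0 : ℝ) (Set.Ioi 0), s ∈ Set.Ioo 0 ℓ :=
        Ioo_mem_nhdsGT (ht.1.trans_lt ht.2)
      refine tendsto_integral_filter_of_dominated_convergence (fun _ => ((D * A : ℝ≥0) : ℝ)) ?_ ?_
        (integrable_const _) ?_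
      · filter_upwards [hev] with s hs
        refine Continuous.aestronglyMeasurable ?_
        exact continuous_const.mul ((hu.continuous.comp
          (hXL s (Set.Ioo_subset_Icc_self hs)).continuous).sub hu.continuous)
      · filter_upwards [hev] with s hs
        refine ae_of_all _ fun x => ?_
        have h1 := hu.dist_le_mul (X s x) x
        have h2 := norm_sub_le_of_flow hV1 hX (s := 0) (t := s) ⟨le_rfl, ht'.1.trans ht'.2⟩
          (Set.Ioo_subset_Icc_self hs) x
        rw [hX0, sub_zero, abs_of_pos hs.1] at h2
        rw [norm_mul, norm_inv, Real.norm_of_nonneg hs.1.le, inv_mul_le_iff₀ hs.1, mul_comm s]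
        rw [dist_eq_norm, dist_eq_norm] at h1
        exact h1.trans (by gcongr)
      -- Rademacher's theorem holds outside a Haar null set, which is `σ`-null by absolute
      -- continuity.
      · filter_upwards [hσ.ae_le (hu.ae_differentiableAt)] with x hx
        have h0 : (0 : ℝ) ∈ Set.Icc 0 ℓ := ⟨le_rfl, ht'.1.trans ht'.2⟩
        have h1 : HasDerivAt (fun s => ψ (X t (X s x)))
            (fderiv ℝ (fun x => ψ (X t x)) x (V x)) 0 := by
          have h2 := hX 0 h0 x
          rw [hX0] at h2
          have h3 : HasFDerivAt (fun x => ψ (X t x)) (fderiv ℝ (fun x => ψ (X t x)) x) (X 0 x) := by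
            rw [hX0]; exact hx.hasFDerivAt
          exact HasFDerivAt.comp_hasDerivAt (l := fun x => ψ (X t x)) 0 h3 h2
        have h4 := (hasDerivWithinAt_iff_tendsto_slope' (by simp)).1
          (h1.hasDerivWithinAt (s := Set.Ioi 0))
        refine h4.congr fun s => ?_
        simp [slope_def_field, hX0, div_eq_inv_mul]
    rw [hdiv _ _ hu hu'] at hlim
    have hshift : Filter.Tendsto (fun s => s - t) (nhdsWithin t (Set.Ioi t))
        (nhdsWithin 0 (Set.Ioi 0)) := by
      refine tendsto_nhdsWithin_iff.2 ⟨?_, ?_⟩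
      · refine Filter.Tendsto.mono_left ?_ nhdsWithin_le_nhds
        have : Continuous fun s => s - t := by fun_prop
        simpa using this.tendsto t
      · filter_upwards [self_mem_nhdsWithin] with s hs
        exact sub_pos.2 (Set.mem_Ioi.1 hs)
    refine (hlim.comp hshift).congr' ?_
    filter_upwards [Ioo_mem_nhdsGT ht.2] with s hs
    have hint : ∀ r ∈ Set.Icc 0 ℓ, Integrable (fun x => ψ (X r x)) σ := fun r hr =>
      Integrable.of_bound (hψ.continuous.comp (hXL r hr).continuous).aestronglyMeasurable B
        (ae_of_all _ fun x => hB _)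
    rw [Function.comp, integral_const_mul, slope_def_field, div_eq_inv_mul,
      ← integral_sub (hint s ⟨ht.1.trans hs.1.le, hs.2.le⟩) (hint t ht')]
    congr 1
    refine integral_congr_ae (ae_of_all _ fun x => ?_)
    dsimp only
    rw [← hXadd _ _ _ (by linarith [hs.1]) ht.1 (by linarith [hs.2]), sub_add_cancel]
  have := constant_of_has_deriv_right_zero hcont hderiv t ht
  simpa [hX0] using this
end

/-! ### The space of curves and measures on trajectories. -/

section
variable {E : Type*} [NormedAddCommGroup E] {ℓ : ℝ}

theorem continuous_uncurry_IccExtend (hℓ : 0 ≤ ℓ) :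
    Continuous fun p : C(Set.Icc (0 : ℝ) ℓ, E) × ℝ => Set.IccExtend hℓ p.1 p.2 := by
  have : Continuous fun p : C(Set.Icc (0 : ℝ) ℓ, E) × ℝ => p.1 (Set.projIcc 0 ℓ hℓ p.2) :=
    continuous_fst.eval (continuous_projIcc.comp continuous_snd)
  exact this

theorem isClosed_setOf_lipschitzWith_one : IsClosed
    {γ : C(Set.Icc (0 : ℝ) ℓ, E) | LipschitzWith 1 γ} := by
  have : {γ : C(Set.Icc (0 : ℝ) ℓ, E) | LipschitzWith 1 γ} =
      ⋂ (s : Set.Icc (0 : ℝ) ℓ) (t : Set.Icc (0 : ℝ) ℓ), {γ | dist (γ s) (γ t) ≤ dist s t} := by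
    ext γ
    simp only [Set.mem_iInter, Set.mem_ofPred_eq, lipschitzWith_iff_dist_le_mul, NNReal.coe_one,
        one_mul]
  rw [this]
  refine isClosed_iInter fun s => isClosed_iInter fun t => isClosed_le ?_ continuous_const
  exact (continuous_eval_const s).dist (continuous_eval_const t)

theorem continuous_integral_IccExtend [NormedSpace ℝ E] (hℓ : 0 ≤ ℓ) {c : E → E}
    (hc : Continuous c) (t : ℝ) :
    Continuous fun γ : C(Set.Icc (0 : ℝ) ℓ, E) => ∫ s in 0..t, c (Set.IccExtend hℓ γ s) :=
  intervalIntegral.continuous_parametric_intervalIntegral_of_continuous'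
    (f := fun (γ : C(Set.Icc (0 : ℝ) ℓ, E)) s => c (Set.IccExtend hℓ γ s))
    (hc.comp (continuous_uncurry_IccExtend hℓ)) _ _
end

section
variable {E : Type*} [NormedAddCommGroup E] [MeasurableSpace E] [BorelSpace E] {ℓ : ℝ}
  [MeasurableSpace C(Set.Icc (0 : ℝ) ℓ, E)] [BorelSpace C(Set.Icc (0 : ℝ) ℓ, E)]

theorem measurable_curve_eval (t : Set.Icc (0 : ℝ) ℓ) :
    Measurable fun γ : C(Set.Icc (0 : ℝ) ℓ, E) => γ t :=
  (continuous_eval_const t).measurable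

theorem measurable_uncurry_IccExtend [SecondCountableTopology E] (hℓ : 0 ≤ ℓ) :
    Measurable fun p : C(Set.Icc (0 : ℝ) ℓ, E) × ℝ => Set.IccExtend hℓ p.1 p.2 :=
  (continuous_uncurry_IccExtend hℓ).measurable

/-- If all one-time marginals of a measure on curves equal `σ`, then the average occupation measure
of the curves is `ℓ σ`. -/
theorem lintegral_lintegral_IccExtend [SecondCountableTopology E] (hℓ : 0 ≤ ℓ)
    {η : Measure C(Set.Icc (0 : ℝ) ℓ, E)}
    [IsFiniteMeasure η] {σ : Measure E}
        (hη : ∀ t, η.map (fun γ : C(Set.Icc (0 : ℝ) ℓ, E) => γ t) = σ) {f : E → ℝ≥0∞}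
    (hf : Measurable f) :
    ∫⁻ γ : C(Set.Icc (0 : ℝ) ℓ, E), (∫⁻ s in Set.Icc 0 ℓ, f (Set.IccExtend hℓ γ s)) ∂η =
        ENNReal.ofReal ℓ * ∫⁻ x, f x ∂σ := by
  have hm := hf.comp (measurable_uncurry_IccExtend (E := E) hℓ)
  rw [lintegral_lintegral_swap
      (f := fun (γ : C(Set.Icc (0 : ℝ) ℓ, E)) (s : ℝ) => f (Set.IccExtend hℓ γ s))
    hm.aemeasurable]
  have h1 : ∀ s, ∫⁻ γ : C(Set.Icc (0 : ℝ) ℓ, E), f (Set.IccExtend hℓ γ s) ∂η = ∫⁻ x, f x ∂σ :=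
    fun s => by
      rw [← hη (Set.projIcc 0 ℓ hℓ s), lintegral_map hf (measurable_curve_eval _)]
      rfl
  simp_rw [h1]
  rw [setLIntegral_const, Real.volume_Icc, sub_zero, mul_comm]

/-- The measure is the image of `σ` under the map from a point to its trajectory; the marginals are
`σ` because the flow preserves it. -/
theorem LipschitzWith.exists_measure_curves [NormedSpace ℝ E] [FiniteDimensional ℝ E] (hℓ : 0 ≤ ℓ)
    {V : E → E} {L : ℝ≥0}
    (hV : LipschitzWith L V) (hV1 : ∀ x, ‖V x‖ ≤ 1) {σ : Measure E} [IsFiniteMeasure σ]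
    (hσ : σ ≪ Measure.addHaar)
    (hdiv : ∀ (u : E → ℝ) (D : ℝ≥0), LipschitzWith D u → HasCompactSupport u →
        ∫ x, fderiv ℝ u x (V x) ∂σ = 0) :
    ∃ η : Measure C(Set.Icc (0 : ℝ) ℓ, E), IsFiniteMeasure η ∧
      (∀ t, η.map (fun γ : C(Set.Icc (0 : ℝ) ℓ, E) => γ t) = σ) ∧
      ∀ᵐ γ : C(Set.Icc (0 : ℝ) ℓ, E) ∂η, LipschitzWith 1 γ ∧ ∀ t : Set.Icc (0 : ℝ) ℓ,
        γ t - γ ⟨0, Set.left_mem_Icc.2 hℓ⟩ = ∫ s in 0..t.1, V (Set.IccExtend hℓ γ s) := by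
  obtain ⟨X, hX0, hX, hXadd, A, hXL⟩ := hV.exists_flow hV1 hℓ
  have hcont : Continuous fun p : E × Set.Icc (0 : ℝ) ℓ => X p.2.1 p.1 := by
    refine continuous_prod_of_continuous_lipschitzWith _ A (fun x => ?_) fun t => hXL t.1 t.2
    refine continuous_iff_continuousAt.2 fun t => ?_
    exact (hX t.1 t.2 x).continuousAt.comp continuous_subtype_val.continuousAt
  let Φ : E → C(Set.Icc (0 : ℝ) ℓ, E) := fun x =>
    ⟨fun t => X t.1 x, hcont.comp (Continuous.prodMk_right x)⟩
  have hΦ : Continuous Φ := ContinuousMap.continuous_of_continuous_uncurry _ hcont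
  refine ⟨σ.map Φ, inferInstance, fun t => ?_, ?_⟩
  · rw [Measure.map_map (measurable_curve_eval t) hΦ.measurable]
    exact map_flow_eq hV1 hX0 hX hXadd hXL hσ hdiv t.2
  · have hall : ∀ x, LipschitzWith 1 (Φ x) ∧ ∀ t : Set.Icc (0 : ℝ) ℓ,
        Φ x t - Φ x ⟨0, Set.left_mem_Icc.2 hℓ⟩ = ∫ s in 0..t.1, V (Set.IccExtend hℓ (Φ x) s) := by
      intro x
      refine ⟨LipschitzWith.of_dist_le_mul fun s t => ?_, fun t => ?_⟩
      · rw [NNReal.coe_one, one_mul, dist_eq_norm, Subtype.dist_eq, Real.dist_eq]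
        exact norm_sub_le_of_flow hV1 hX t.2 s.2 x
      · have h1 : ∀ s ∈ Set.uIcc 0 t.1, HasDerivAt (fun s => X s x)
            (V (Set.IccExtend hℓ (Φ x) s)) s := fun s hs => by
          rw [Set.uIcc_of_le t.2.1] at hs
          have hs' : s ∈ Set.Icc 0 ℓ := ⟨hs.1, hs.2.trans t.2.2⟩
          rw [Set.IccExtend_of_mem _ _ hs']
          exact hX s hs' x
        rw [intervalIntegral.integral_eq_sub_of_hasDerivAt h1]
        · rfl
        · refine Continuous.intervalIntegrable ?_ _ _
          exact hV.continuous.comp ((Φ x).continuous.Icc_extend')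
    -- Transporting the property through `Φ` needs it to be measurable; it is even closed for
    -- uniform convergence because `V` is continuous.
    refine (ae_map_iff hΦ.measurable.aemeasurable ?_).2 (ae_of_all _ hall)
    refine IsClosed.measurableSet (isClosed_setOf_lipschitzWith_one.inter ?_)
    have : {γ : C(Set.Icc (0 : ℝ) ℓ, E) | ∀ t : Set.Icc (0 : ℝ) ℓ,
        γ t - γ ⟨0, Set.left_mem_Icc.2 hℓ⟩ = ∫ s in 0..t.1, V (Set.IccExtend hℓ γ s)} =
        ⋂ t : Set.Icc (0 : ℝ) ℓ, {γ : C(Set.Icc (0 : ℝ) ℓ, E) | γ t - γ ⟨0, Set.left_mem_Icc.2 hℓ⟩ =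
          ∫ s in 0..t.1, V (Set.IccExtend hℓ γ s)} := by
      ext γ; simp
    change IsClosed {γ : C(Set.Icc (0 : ℝ) ℓ, E) | ∀ t : Set.Icc (0 : ℝ) ℓ,
        γ t - γ ⟨0, Set.left_mem_Icc.2 hℓ⟩ = ∫ s in 0..t.1, V (Set.IccExtend hℓ γ s)}
    rw [this]
    refine isClosed_iInter fun t => isClosed_eq ?_
        (continuous_integral_IccExtend hℓ hV.continuous _)
    exact (continuous_eval_const t).sub (continuous_eval_const _)
end

/-! ### Compactness and passage to the limit. -/

open Filter Topology in
-- Arzelà–Ascoli: the curves are equicontinuous, and as functions they form a pointwise closed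
-- subset of a product of balls of radius `R + ℓ`.
theorem isCompact_lipschitz_curves {E : Type*} [NormedAddCommGroup E] [ProperSpace E] {ℓ : ℝ}
    (hℓ : 0 ≤ ℓ) (R : ℝ) :
    IsCompact {γ : C(Set.Icc (0 : ℝ) ℓ, E) |
      LipschitzWith 1 γ ∧ ‖γ ⟨0, Set.left_mem_Icc.2 hℓ⟩‖ ≤ R} := by
  refine ArzelaAscoli.isCompact_of_equicontinuous _ ?_ ?_
  · have himg : ContinuousMap.toFun '' {γ : C(Set.Icc (0 : ℝ) ℓ, E) |
        LipschitzWith 1 γ ∧ ‖γ ⟨0, Set.left_mem_Icc.2 hℓ⟩‖ ≤ R} =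
        {f : Set.Icc (0 : ℝ) ℓ → E | (∀ s t, dist (f s) (f t) ≤ dist s t) ∧
          ‖f ⟨0, Set.left_mem_Icc.2 hℓ⟩‖ ≤ R} := by
      ext f
      constructor
      · rintro ⟨γ, ⟨h1, h2⟩, rfl⟩
        exact ⟨fun s t => by simpa using! h1.dist_le_mul s t, h2⟩
      · rintro ⟨h1, h2⟩
        have h3 : LipschitzWith 1 f := LipschitzWith.of_dist_le_mul fun s t => by simpa using h1 s t
        exact ⟨⟨f, h3.continuous⟩, ⟨h3, h2⟩, rfl⟩
    rw [himg]
    refine IsCompact.of_isClosed_subset (isCompact_univ_pi fun _ : Set.Icc (0 : ℝ) ℓ =>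
      isCompact_closedBall (0 : E) (R + ℓ)) ?_ ?_
    · refine IsClosed.and ?_ (isClosed_le (by fun_prop) continuous_const)
      simp only [Set.ofPred_forall]
      exact isClosed_iInter fun s => isClosed_iInter fun t =>
        isClosed_le (by fun_prop) continuous_const
    · rintro f ⟨h1, h2⟩ t -
      rw [mem_closedBall_zero_iff]
      have h3 := h1 t ⟨0, Set.left_mem_Icc.2 hℓ⟩
      rw [dist_eq_norm, Subtype.dist_eq, Real.dist_eq, sub_zero, abs_of_nonneg t.2.1] at h3
      have h4 := norm_sub_norm_le (f t) (f ⟨0, Set.left_mem_Icc.2 hℓ⟩)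
      linarith [t.2.2]
  · refine (LipschitzWith.uniformEquicontinuous _ 1 fun γ => ?_).equicontinuous
    exact γ.2.1

open Filter Topology in
-- Prokhorov's theorem. A limit along an ultrafilter finer than `atTop` serves in place of a
-- convergent subsequence.
theorem exists_ultrafilter_tendsto_measure_curves {E : Type*} [NormedAddCommGroup E] [ProperSpace E]
    {ℓ : ℝ} [MeasurableSpace C(Set.Icc (0 : ℝ) ℓ, E)] [BorelSpace C(Set.Icc (0 : ℝ) ℓ, E)]
    (hℓ : 0 ≤ ℓ) (η : ℕ → Measure C(Set.Icc (0 : ℝ) ℓ, E)) [∀ k, IsFiniteMeasure (η k)] (M : ℝ≥0)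
    (hM : ∀ k, η k Set.univ ≤ M) {u : ℕ → ℝ≥0} (hu : Tendsto u atTop (𝓝 0))
    (hηu : ∀ (k N : ℕ), η k {γ : C(Set.Icc (0 : ℝ) ℓ, E) |
      LipschitzWith 1 γ ∧ ‖γ ⟨0, Set.left_mem_Icc.2 hℓ⟩‖ ≤ N}ᶜ ≤ u N) :
    ∃ (𝒰 : Ultrafilter ℕ) (ζ : Measure C(Set.Icc (0 : ℝ) ℓ, E)), (𝒰 : Filter ℕ) ≤ atTop ∧
      IsFiniteMeasure ζ ∧ ∀ f : BoundedContinuousFunction C(Set.Icc (0 : ℝ) ℓ, E) ℝ,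
        Tendsto (fun k => ∫ γ, f γ ∂η k) 𝒰 (𝓝 (∫ γ, f γ ∂ζ)) := by
  have hc := isCompact_setOfPred_finiteMeasure_mass_le_compl_isCompact_le
    (E := C(Set.Icc (0 : ℝ) ℓ, E)) M hu
    (fun N => isCompact_lipschitz_curves (E := E) hℓ (N : ℝ)) (Or.inl inferInstance)
  let η' : ℕ → FiniteMeasure C(Set.Icc (0 : ℝ) ℓ, E) := fun k => ⟨η k, inferInstance⟩
  obtain ⟨ζ, -, hζ⟩ := hc.ultrafilter_le_nhds' ((hyperfilter ℕ).map η') (by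
    rw [Ultrafilter.mem_map]
    refine univ_mem' fun k => ⟨?_, fun N => ?_⟩
    · rw [← ENNReal.coe_le_coe, FiniteMeasure.ennreal_mass]
      exact hM k
    · rw [← ENNReal.coe_le_coe, FiniteMeasure.ennreal_coeFn_eq_coeFn_toMeasure]
      exact hηu k N)
  refine ⟨hyperfilter ℕ, ζ, Nat.hyperfilter_le_atTop, inferInstance, fun f => ?_⟩
  exact (FiniteMeasure.tendsto_iff_forall_integral_tendsto.1 hζ) f

section
open Filter Topology
variable {E : Type*} [NormedAddCommGroup E] [NormedSpace ℝ E] [SecondCountableTopology E]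
  [MeasurableSpace E] [BorelSpace E]

theorem conv_map_smul (ρ κ : Measure E) [SFinite ρ] [SFinite κ] (a : ℝ) :
    ρ.conv (κ.map fun x => a • x) = (ρ.prod κ).map fun p => p.1 + a • p.2 := by
  have hm : Measurable fun x : E => a • x := measurable_const_smul a
  have h := Measure.map_prod_map ρ κ measurable_id hm
  rw [Measure.map_id] at h
  rw [Measure.conv, h, Measure.map_map measurable_add (measurable_id.prodMap hm)]
  rfl

/-- Only `c` is evaluated at the displaced point, so dominated convergence needs no continuity of
`b`. -/
theorem tendsto_lintegral_conv_smul (ρ κ : Measure E) [IsFiniteMeasure ρ] [IsProbabilityMeasure κ]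
    {b c : E → E} (hb : Measurable b) (hb1 : ∀ x, ‖b x‖ ≤ 1) (hc : Continuous c) {A : ℝ}
    (hA : ∀ x, ‖c x‖ ≤ A) {ε : ℕ → ℝ} (hε : Tendsto ε atTop (𝓝 0)) :
    Tendsto (fun k => ∫⁻ z, ∫⁻ y, ‖b z - c (z + ε k • y)‖ₑ ∂κ ∂ρ) atTop
      (𝓝 (∫⁻ z, ‖b z - c z‖ₑ ∂ρ)) := by
  have h1 : ∀ k, ∫⁻ z, ∫⁻ y, ‖b z - c (z + ε k • y)‖ₑ ∂κ ∂ρ =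
      ∫⁻ p, ‖b p.1 - c (p.1 + ε k • p.2)‖ₑ ∂(ρ.prod κ) := fun k => by
    have hcm := hc.measurable
    rw [lintegral_prod _ (Measurable.aemeasurable (by fun_prop))]
  have h2 : ∫⁻ z, ‖b z - c z‖ₑ ∂ρ = ∫⁻ p, ‖b p.1 - c p.1‖ₑ ∂(ρ.prod κ) := by
    have hcm := hc.measurable
    rw [lintegral_prod _ (Measurable.aemeasurable (by fun_prop))]
    simp
  simp_rw [h1, h2]
  refine tendsto_lintegral_of_dominated_convergence (fun _ => ENNReal.ofReal (1 + A))
    (fun k => ?_) (fun k => ae_of_all _ fun p => ?_) ?_ (ae_of_all _ fun p => ?_)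
  · have hcm := hc.measurable
    fun_prop
  · dsimp only
    rw [← ofReal_norm]
    exact ENNReal.ofReal_le_ofReal ((norm_sub_le _ _).trans (add_le_add (hb1 _) (hA _)))
  · rw [lintegral_const]
    exact ENNReal.mul_ne_top ENNReal.ofReal_ne_top (measure_ne_top _ _)
  · refine (continuous_enorm.tendsto _).comp (tendsto_const_nhds.sub ((hc.tendsto _).comp ?_))
    have := (tendsto_const_nhds (x := p.1)).add (hε.smul_const p.2)
    simpa using this

theorem tendsto_integral_conv_smul (ρ κ : Measure E) [IsFiniteMeasure ρ] [IsProbabilityMeasure κ]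
    (g : BoundedContinuousFunction E ℝ) {ε : ℕ → ℝ} (hε : Tendsto ε atTop (𝓝 0)) :
    Tendsto (fun k => ∫ x, g x ∂(ρ.conv (κ.map fun x => ε k • x))) atTop (𝓝 (∫ x, g x ∂ρ)) := by
  have hmeas : ∀ k, Measurable fun p : E × E => p.1 + ε k • p.2 := fun k => by fun_prop
  have h1 : ∀ k, ∫ x, g x ∂(ρ.conv (κ.map fun x => ε k • x)) =
      ∫ p, g (p.1 + ε k • p.2) ∂(ρ.prod κ) := fun k => by
    rw [conv_map_smul, integral_map (hmeas k).aemeasurable g.continuous.aestronglyMeasurable]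
  have h2 : ∫ x, g x ∂ρ = ∫ p, g p.1 ∂(ρ.prod κ) := by
    rw [integral_fun_fst]
    simp
  simp_rw [h1, h2]
  refine tendsto_integral_of_dominated_convergence (fun _ => ‖g‖)
    (fun k => (g.continuous.measurable.comp (hmeas k)).aestronglyMeasurable) (integrable_const _)
    (fun k => ae_of_all _ fun p => g.norm_coe_le_norm _) (ae_of_all _ fun p => ?_)
  refine (g.continuous.tendsto _).comp ?_
  have := (tendsto_const_nhds (x := p.1)).add (hε.smul_const p.2)
  simpa using this
end

theorem intervalIntegrable_comp_IccExtend {E : Type*} [NormedAddCommGroup E] [NormedSpace ℝ E]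
    [FiniteDimensional ℝ E] [MeasurableSpace E] [BorelSpace E] {ℓ : ℝ} (hℓ : 0 ≤ ℓ) {b : E → E}
        (hb : Measurable b) {A : ℝ}
    (hA : ∀ x, ‖b x‖ ≤ A) (γ : C(Set.Icc (0 : ℝ) ℓ, E)) (r t : ℝ) :
    IntervalIntegrable (fun s => b (Set.IccExtend hℓ γ s)) volume r t := by
  refine (intervalIntegrable_const (c := A)).mono_fun' ?_ (ae_of_all _ fun s => hA _)
  exact (hb.comp γ.continuous.Icc_extend'.measurable).aestronglyMeasurable

/-! ### The superposition principle. -/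

section
open Filter Topology
variable {E : Type*} [NormedAddCommGroup E] [NormedSpace ℝ E] [FiniteDimensional ℝ E]
  [MeasurableSpace E] [BorelSpace E] {ℓ : ℝ} [MeasurableSpace C(Set.Icc (0 : ℝ) ℓ, E)]
  [BorelSpace C(Set.Icc (0 : ℝ) ℓ, E)]

/-- Turns `L¹(σ)` closeness of two fields, even merely Borel ones, into closeness in mean of their
integrals along curves. -/
theorem lintegral_enorm_integral_IccExtend_le (hℓ : 0 ≤ ℓ) {η : Measure C(Set.Icc (0 : ℝ) ℓ, E)}
    [IsFiniteMeasure η] {σ : Measure E}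
    (hη : ∀ t, η.map (fun γ : C(Set.Icc (0 : ℝ) ℓ, E) => γ t) = σ)
    {f : E → E} (hf : Measurable f) {t : ℝ} (ht : t ∈ Set.Icc 0 ℓ) :
    ∫⁻ γ : C(Set.Icc (0 : ℝ) ℓ, E), ‖∫ s in 0..t, f (Set.IccExtend hℓ γ s)‖ₑ ∂η ≤
      ENNReal.ofReal ℓ * ∫⁻ x, ‖f x‖ₑ ∂σ := by
  rw [← lintegral_lintegral_IccExtend hℓ hη (f := fun x => ‖f x‖ₑ) (by fun_prop)]
  refine lintegral_mono fun γ => ?_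
  rw [intervalIntegral.integral_of_le ht.1]
  refine (enorm_integral_le_lintegral_enorm _).trans (lintegral_mono_set ?_)
  exact Set.Ioc_subset_Icc_self.trans (Set.Icc_subset_Icc_right ht.2)

/-- Limits of measures on solutions of `γ' = V_k(γ)` with marginals `σ_k` are concentrated
on approximate solutions of `γ' = c(γ)`. -/
theorem lintegral_min_one_enorm_le_of_tendsto (hℓ : 0 ≤ ℓ)
    {η : ℕ → Measure C(Set.Icc (0 : ℝ) ℓ, E)} [∀ k, IsFiniteMeasure (η k)] {σ : ℕ → Measure E}
    (hη : ∀ k t, (η k).map (fun γ : C(Set.Icc (0 : ℝ) ℓ, E) => γ t) = σ k)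
    {V : ℕ → E → E} (hV : ∀ k, Continuous (V k))
    (hηV : ∀ k, ∀ᵐ γ : C(Set.Icc (0 : ℝ) ℓ, E) ∂η k, ∀ t : Set.Icc (0 : ℝ) ℓ,
        γ t - γ ⟨0, Set.left_mem_Icc.2 hℓ⟩ = ∫ s in 0..t.1, V k (Set.IccExtend hℓ γ s))
    {𝒰 : Filter ℕ} [𝒰.NeBot] {ζ : Measure C(Set.Icc (0 : ℝ) ℓ, E)} [IsFiniteMeasure ζ]
    (hζ : ∀ f : BoundedContinuousFunction C(Set.Icc (0 : ℝ) ℓ, E) ℝ,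
        Tendsto (fun k => ∫ γ, f γ ∂η k) 𝒰 (𝓝 (∫ γ, f γ ∂ζ)))
    {c : E → E} (hc : Continuous c) {J : ℕ → ℝ≥0∞} {J' : ℝ≥0∞} (hJ : Tendsto J 𝒰 (𝓝 J'))
    (hVJ : ∀ k, ∫⁻ x, ‖V k x - c x‖ₑ ∂σ k ≤ J k) (t : Set.Icc (0 : ℝ) ℓ) :
    ∫⁻ γ : C(Set.Icc (0 : ℝ) ℓ, E), min 1 ‖γ t - γ ⟨0, Set.left_mem_Icc.2 hℓ⟩ -
      ∫ s in 0..t.1, c (Set.IccExtend hℓ γ s)‖ₑ ∂ζ ≤ ENNReal.ofReal ℓ * J' := by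
  -- Truncation at 1 and continuity of `c` make the defect of the integral equation an admissible
  -- test function for weak convergence.
  let G : C(Set.Icc (0 : ℝ) ℓ, E) → ℝ := fun γ => min 1 ‖γ t - γ ⟨0, Set.left_mem_Icc.2 hℓ⟩ -
      ∫ s in 0..t.1, c (Set.IccExtend hℓ γ s)‖
  have hG : Continuous G := continuous_const.min
    (((continuous_eval_const t).sub (continuous_eval_const _)).sub
      (continuous_integral_IccExtend hℓ hc _)).norm
  have hG0 : ∀ γ, 0 ≤ G γ := fun γ => le_min zero_le_one (norm_nonneg _)
  let G' : BoundedContinuousFunction C(Set.Icc (0 : ℝ) ℓ, E) ℝ :=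
    BoundedContinuousFunction.ofNormedAddCommGroup G hG 1 fun γ => by
      rw [Real.norm_of_nonneg (hG0 γ)]; exact min_le_left _ _
  have hofReal : ∀ γ, ENNReal.ofReal (G γ) = min 1 ‖γ t - γ ⟨0, Set.left_mem_Icc.2 hℓ⟩ -
      ∫ s in 0..t.1, c (Set.IccExtend hℓ γ s)‖ₑ := fun γ => by
    simp only [G]
    rw [ENNReal.ofReal_min, ofReal_norm, ENNReal.ofReal_one]
  have hlin : ∀ (θ : Measure C(Set.Icc (0 : ℝ) ℓ, E)) [IsFiniteMeasure θ],
      ENNReal.ofReal (∫ γ, G' γ ∂θ) = ∫⁻ γ : C(Set.Icc (0 : ℝ) ℓ, E),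
        min 1 ‖γ t - γ ⟨0, Set.left_mem_Icc.2 hℓ⟩ -
          ∫ s in 0..t.1, c (Set.IccExtend hℓ γ s)‖ₑ ∂θ := fun θ _ => by
    rw [ofReal_integral_eq_lintegral_ofReal (G'.integrable θ) (ae_of_all _ hG0)]
    exact lintegral_congr hofReal
  rw [← hlin]
  refine le_of_tendsto_of_tendsto' ((ENNReal.continuous_ofReal.tendsto _).comp (hζ G'))
    (ENNReal.Tendsto.const_mul hJ (Or.inr ENNReal.ofReal_ne_top)) fun k => ?_
  rw [Function.comp, hlin]
  refine le_trans ?_ (mul_le_mul_right (hVJ k) _)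
  refine le_trans ?_ (lintegral_enorm_integral_IccExtend_le hℓ (hη k) (f := fun x => V k x - c x)
    (((hV k).sub hc).measurable) t.2)
  refine lintegral_mono_ae ((hηV k).mono fun γ hγ => (min_le_right _ _).trans (le_of_eq ?_))
  rw [hγ t, intervalIntegral.integral_sub]
  · exact ((hV k).comp γ.continuous.Icc_extend').intervalIntegrable _ _
  · exact (hc.comp γ.continuous.Icc_extend').intervalIntegrable _ _

/-- The superposition principle for a bounded Borel field `b` and a finite measure `ρ` with
`div (b ρ) = 0`. -/
theorem exists_superposition (hℓ : 0 ≤ ℓ) (ρ : Measure E) [IsFiniteMeasure ρ] {b : E → E}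
    (hb : Measurable b) (hb1 : ∀ x, ‖b x‖ ≤ 1)
    (hdiv : ∀ ψ : E → ℝ, ContDiff ℝ ∞ ψ → HasCompactSupport ψ → ∫ x, fderiv ℝ ψ x (b x) ∂ρ = 0) :
    ∃ ζ : Measure C(Set.Icc (0 : ℝ) ℓ, E), IsFiniteMeasure ζ ∧
      (∀ t, ζ.map (fun γ : C(Set.Icc (0 : ℝ) ℓ, E) => γ t) = ρ) ∧
      ∀ᵐ γ : C(Set.Icc (0 : ℝ) ℓ, E) ∂ζ, ∀ t : Set.Icc (0 : ℝ) ℓ,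
        γ t - γ ⟨0, Set.left_mem_Icc.2 hℓ⟩ = ∫ s in 0..t.1, b (Set.IccExtend hℓ γ s) := by
  -- The mollified field divides by `K * ρ`, so `ρ = 0` is separate.
  rcases eq_or_ne ρ 0 with rfl | hρ0
  · exact ⟨0, inferInstance, fun t => Measure.map_zero _, by simp⟩
  have : NeZero ρ := ⟨hρ0⟩
  obtain ⟨κ, hκ, happrox⟩ := exists_mollification ρ hb hb1 hdiv
  let ε : ℕ → ℝ := fun k => 1 / ((k : ℝ) + 1)
  have hε0 : ∀ k, 0 < ε k := fun k => by positivity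
  have hε1 : ∀ k, ε k ≤ 1 := fun k => by
    simp only [ε]
    rw [div_le_one (by positivity)]
    simp
  have hε : Tendsto ε atTop (𝓝 0) := tendsto_one_div_add_atTop_nhds_zero_nat
  choose V L hVL hV1 hac hVdiv hVc using fun k => happrox (ε k) (hε0 k)
  have hprob : ∀ k, IsProbabilityMeasure (κ.map fun x => ε k • x) := fun k =>
    Measure.isProbabilityMeasure_map (measurable_const_smul (ε k)).aemeasurable
  choose η hηfin hη hηae using fun k =>
    (hVL k).exists_measure_curves hℓ (hV1 k) (hac k) (hVdiv k)
  have hevalm : ∀ t : Set.Icc (0 : ℝ) ℓ, Measurable fun γ : C(Set.Icc (0 : ℝ) ℓ, E) => γ t :=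
    fun t => measurable_curve_eval t
  have hconvm : ∀ k, Measurable fun p : E × E => p.1 + ε k • p.2 := fun k => by fun_prop
  -- tightness
  let u : ℕ → ℝ≥0 := fun N => ((ρ.prod κ) {p | (N : ℝ) < ‖p.1‖ + ‖p.2‖}).toNNReal
  have hu : Tendsto u atTop (𝓝 0) := by
    have h1 : Tendsto (fun N : ℕ => (ρ.prod κ) {p | (N : ℝ) < ‖p.1‖ + ‖p.2‖}) atTop (𝓝 0) := by
      have h2 := tendsto_measure_iInter_atTop (μ := ρ.prod κ)
        (s := fun N : ℕ => {p : E × E | (N : ℝ) < ‖p.1‖ + ‖p.2‖})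
        (fun N => (measurableSet_lt measurable_const (by fun_prop)).nullMeasurableSet)
        (fun N N' h p hp => lt_of_le_of_lt (Nat.cast_le.2 h : (N : ℝ) ≤ N') hp) ⟨0,
            measure_ne_top _ _⟩
      have h3 : ⋂ N : ℕ, {p : E × E | (N : ℝ) < ‖p.1‖ + ‖p.2‖} = ∅ := by
        ext p
        obtain ⟨N, hN⟩ := exists_nat_ge (‖p.1‖ + ‖p.2‖)
        simpa using ⟨N, hN⟩
      rwa [h3, measure_empty] at h2
    exact (ENNReal.tendsto_toNNReal ENNReal.zero_ne_top).comp h1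
  -- The starting point is distributed as `z + ε k • y` under `ρ.prod κ`. Since `ε k ≤ 1`, its norm
  -- is at most `‖z‖ + ‖y‖`, and one tail bound serves all `k`.
  have htight : ∀ k N : ℕ, η k {γ : C(Set.Icc (0 : ℝ) ℓ, E) |
      LipschitzWith 1 γ ∧ ‖γ ⟨0, Set.left_mem_Icc.2 hℓ⟩‖ ≤ N}ᶜ ≤ u N := by
    intro k N
    have hms : MeasurableSet {x : E | (N : ℝ) < ‖x‖} :=
      measurableSet_lt measurable_const measurable_norm
    calc η k {γ : C(Set.Icc (0 : ℝ) ℓ, E) |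
          LipschitzWith 1 γ ∧ ‖γ ⟨0, Set.left_mem_Icc.2 hℓ⟩‖ ≤ N}ᶜ
        ≤ η k ((fun γ : C(Set.Icc (0 : ℝ) ℓ, E) => γ ⟨0, Set.left_mem_Icc.2 hℓ⟩) ⁻¹'
            {x : E | (N : ℝ) < ‖x‖}) := by
          refine measure_mono_ae ((hηae k).mono fun γ hγ hmem => ?_)
          by_contra hcon
          exact hmem ⟨hγ.1, not_lt.1 hcon⟩
      _ = (ρ.prod κ) ((fun p : E × E => p.1 + ε k • p.2) ⁻¹' {x : E | (N : ℝ) < ‖x‖}) := by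
          rw [← Measure.map_apply (hevalm _) hms, hη k, conv_map_smul,
            Measure.map_apply (hconvm k) hms]
      _ ≤ (ρ.prod κ) {p | (N : ℝ) < ‖p.1‖ + ‖p.2‖} := by
          refine measure_mono fun p hp => lt_of_lt_of_le hp ((norm_add_le _ _).trans ?_)
          rw [norm_smul, Real.norm_of_nonneg (hε0 k).le]
          have := mul_le_mul_of_nonneg_right (hε1 k) (norm_nonneg p.2)
          linarith
      _ = u N := (ENNReal.coe_toNNReal (measure_ne_top _ _)).symm
  have hmass : ∀ k, η k Set.univ ≤ ((ρ.prod κ Set.univ).toNNReal : ℝ≥0) := fun k => by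
    have h1 : η k Set.univ = (η k).map
        (fun γ : C(Set.Icc (0 : ℝ) ℓ, E) => γ ⟨0, Set.left_mem_Icc.2 hℓ⟩) Set.univ := by
      rw [Measure.map_apply (hevalm _) MeasurableSet.univ, Set.preimage_univ]
    rw [h1, hη k, conv_map_smul, Measure.map_apply (hconvm k) MeasurableSet.univ,
      Set.preimage_univ, ENNReal.coe_toNNReal (measure_ne_top _ _)]
  obtain ⟨𝒰, ζ, h𝒰, hζfin, hζ⟩ :=
    exists_ultrafilter_tendsto_measure_curves hℓ η _ hmass hu htight
  have hmarg : ∀ t, ζ.map (fun γ : C(Set.Icc (0 : ℝ) ℓ, E) => γ t) = ρ := by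
    intro t
    refine ext_of_forall_integral_eq_of_IsFiniteMeasure fun g => ?_
    rw [integral_map (hevalm t).aemeasurable g.continuous.aestronglyMeasurable]
    have h1 := hζ (g.compContinuous ⟨fun γ : C(Set.Icc (0 : ℝ) ℓ, E) => γ t,
        continuous_eval_const t⟩)
    have h2 := (tendsto_integral_conv_smul ρ κ g hε).mono_left h𝒰
    refine tendsto_nhds_unique h1 (h2.congr fun k => ?_)
    rw [← hη k t, integral_map (hevalm t).aemeasurable g.continuous.aestronglyMeasurable]
    rfl
  refine ⟨ζ, hζfin, hmarg, ?_⟩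
  have hbint := fun (γ : C(Set.Icc (0 : ℝ) ℓ, E)) r t =>
    intervalIntegrable_comp_IccExtend hℓ hb hb1 γ r t
  have hIm : ∀ t : ℝ, 0 ≤ t → Measurable fun γ : C(Set.Icc (0 : ℝ) ℓ, E) =>
      ∫ s in 0..t, b (Set.IccExtend hℓ γ s) := by
    intro t ht
    simp_rw [intervalIntegral.integral_of_le ht]
    refine StronglyMeasurable.measurable ?_
    refine StronglyMeasurable.integral_prod_right
      (f := fun (γ : C(Set.Icc (0 : ℝ) ℓ, E)) (s : ℝ) => b (Set.IccExtend hℓ γ s)) ?_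
    exact (hb.comp (measurable_uncurry_IccExtend hℓ)).stronglyMeasurable
  have hone : ∀ t : Set.Icc (0 : ℝ) ℓ, ∀ᵐ γ : C(Set.Icc (0 : ℝ) ℓ, E) ∂ζ,
      γ t - γ ⟨0, Set.left_mem_Icc.2 hℓ⟩ = ∫ s in 0..t.1, b (Set.IccExtend hℓ γ s) := by
    intro t
    have hzero : ∫⁻ γ : C(Set.Icc (0 : ℝ) ℓ, E), min 1 ‖γ t - γ ⟨0, Set.left_mem_Icc.2 hℓ⟩ -
        ∫ s in 0..t.1, b (Set.IccExtend hℓ γ s)‖ₑ ∂ζ = 0 := by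
      -- Choose `c` continuous within `δ` of `b` in `L¹(ρ)`. One `ℓ δ` bounds the limiting defect
      -- for `c`, the other the replacement of `c` by `b` along the limit curves.
      have hle : ∀ δ : ℝ≥0∞, δ ≠ 0 → ∫⁻ γ : C(Set.Icc (0 : ℝ) ℓ, E),
          min 1 ‖γ t - γ ⟨0, Set.left_mem_Icc.2 hℓ⟩ -
            ∫ s in 0..t.1, b (Set.IccExtend hℓ γ s)‖ₑ ∂ζ ≤ 2 * (ENNReal.ofReal ℓ * δ) := by
        intro δ hδ
        have hbi : Integrable b ρ := Integrable.of_bound hb.aestronglyMeasurable 1 (ae_of_all _ hb1)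
        obtain ⟨c, hcs, hcδ, hc, -⟩ := hbi.exists_hasCompactSupport_lintegral_sub_le hδ
        obtain ⟨A, hA⟩ := hc.bounded_above_of_compact_support hcs
        have h1 := lintegral_min_one_enorm_le_of_tendsto hℓ hη (fun k => (hVL k).continuous)
          (fun k => (hηae k).mono fun γ hγ => hγ.2) hζ hc
          ((tendsto_lintegral_conv_smul ρ κ hb hb1 hc hA hε).mono_left h𝒰)
          (fun k => hVc k c hc.measurable) t
        have h2 := lintegral_enorm_integral_IccExtend_le hℓ hmarg (f := fun x => b x - c x)
          (hb.sub hc.measurable) t.2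
        calc _ ≤ ∫⁻ γ : C(Set.Icc (0 : ℝ) ℓ, E), (min 1 ‖γ t - γ ⟨0, Set.left_mem_Icc.2 hℓ⟩ -
              ∫ s in 0..t.1, c (Set.IccExtend hℓ γ s)‖ₑ +
                ‖∫ s in 0..t.1, (b (Set.IccExtend hℓ γ s) - c (Set.IccExtend hℓ γ s))‖ₑ) ∂ζ := by
              refine lintegral_mono fun γ => ?_
              rw [intervalIntegral.integral_sub (hbint γ _ _)
                (g := fun s => c (Set.IccExtend hℓ γ s))
                ((hc.comp γ.continuous.Icc_extend').intervalIntegrable _ _)]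
              set x := γ t - γ ⟨0, Set.left_mem_Icc.2 hℓ⟩
              set y := ∫ s in 0..t.1, b (Set.IccExtend hℓ γ s)
              set z := ∫ s in 0..t.1, c (Set.IccExtend hℓ γ s)
              have h3 : ‖x - y‖ₑ ≤ ‖x - z‖ₑ + ‖y - z‖ₑ := by
                have : x - y = (x - z) - (y - z) := by abel
                rw [this]
                exact enorm_sub_le
              rcases le_total 1 ‖x - z‖ₑ with h4 | h4
              · rw [min_eq_left h4]
                exact (min_le_left _ _).trans le_self_add
              · rw [min_eq_right h4]
                exact (min_le_right _ _).trans h3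
          _ = _ := lintegral_add_left' ?_ _
          _ ≤ ENNReal.ofReal ℓ * δ + ENNReal.ofReal ℓ * δ :=
              add_le_add (h1.trans (by gcongr)) (h2.trans (by gcongr))
          _ = _ := (two_mul _).symm
        refine Measurable.aemeasurable (measurable_const.min ?_)
        exact (((hevalm t).sub (hevalm _)).sub
          (continuous_integral_IccExtend hℓ hc t.1).measurable).enorm
      refine le_antisymm ?_ zero_le
      have hlim : Tendsto (fun k : ℕ => 2 * (ENNReal.ofReal ℓ * ((k : ℝ≥0∞) + 1)⁻¹)) atTop (𝓝 0) :=
          by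
        have h1 : Tendsto (fun k : ℕ => ((k : ℝ≥0∞) + 1)⁻¹) atTop (𝓝 0) := by
          have := (tendsto_add_atTop_iff_nat 1).2 ENNReal.tendsto_inv_nat_nhds_zero
          simpa using this
        have h2 := ENNReal.Tendsto.const_mul h1 (Or.inr (ENNReal.ofReal_ne_top (r := ℓ)))
        have h3 := ENNReal.Tendsto.const_mul h2 (Or.inr (ENNReal.ofNat_ne_top (n := 2)))
        simpa using h3
      exact ge_of_tendsto' hlim fun k => hle _ (by simp)
    rw [lintegral_eq_zero_iff] at hzero
    · filter_upwards [hzero] with γ hγ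
      have h1 : min 1 ‖γ t - γ ⟨0, Set.left_mem_Icc.2 hℓ⟩ -
        ∫ s in 0..t.1, b (Set.IccExtend hℓ γ s)‖ₑ = 0 := hγ
      rcases min_eq_bot.1 h1 with h2 | h2
      · exact absurd h2 one_ne_zero
      · exact sub_eq_zero.1 (enorm_eq_zero.1 h2)
    · refine measurable_const.min ?_
      exact (((hevalm t).sub (hevalm _)).sub (hIm t.1 t.2.1)).enorm
  -- The exceptional set depends on `t`; countably many times suffice as both sides are continuous
  -- in `t`.
  obtain ⟨D, hDc, hDd⟩ := TopologicalSpace.exists_countable_dense (Set.Icc (0 : ℝ) ℓ)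
  filter_upwards [(ae_ball_iff hDc).2 fun t _ => hone t] with γ hγ t
  have hcont : Continuous fun t : Set.Icc (0 : ℝ) ℓ =>
      ∫ s in 0..t.1, b (Set.IccExtend hℓ γ s) :=
    (intervalIntegral.continuous_primitive (hbint γ) 0).comp continuous_subtype_val
  exact congrFun (Continuous.ext_on hDd (γ.continuous.sub continuous_const) hcont hγ) t
end

/-! ### The charge of an integral curve of `b`. -/

section
variable {n : ℕ} {ℓ : ℝ} (hℓ : 0 < ℓ)

/-- The occupation measure of a curve. -/
noncomputable def occupationMeasure (γ : C(Set.Icc (0 : ℝ) ℓ, EuclideanSpace ℝ (Fin n))) :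
    Measure (EuclideanSpace ℝ (Fin n)) :=
  (volume.restrict (Set.Icc 0 ℓ)).map (curveExt hℓ γ)

instance (γ : C(Set.Icc (0 : ℝ) ℓ, EuclideanSpace ℝ (Fin n))) :
    IsFiniteMeasure (occupationMeasure hℓ γ) := by
  unfold occupationMeasure; infer_instance

theorem continuous_curveExt (γ : C(Set.Icc (0 : ℝ) ℓ, EuclideanSpace ℝ (Fin n))) :
    Continuous (curveExt hℓ γ) :=
  γ.continuous.Icc_extend'

theorem occupationMeasure_apply (γ : C(Set.Icc (0 : ℝ) ℓ, EuclideanSpace ℝ (Fin n)))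
    {A : Set (EuclideanSpace ℝ (Fin n))} (hA : MeasurableSet A) :
    occupationMeasure hℓ γ A = ∫⁻ s in Set.Icc 0 ℓ, A.indicator 1 (curveExt hℓ γ s) := by
  rw [occupationMeasure, ← lintegral_indicator_one hA,
    lintegral_map (measurable_one.indicator hA) (continuous_curveExt hℓ γ).measurable]

theorem occupationMeasure_univ (γ : C(Set.Icc (0 : ℝ) ℓ, EuclideanSpace ℝ (Fin n))) :
    occupationMeasure hℓ γ Set.univ = ENNReal.ofReal ℓ := by
  rw [occupationMeasure_apply hℓ γ MeasurableSet.univ]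
  simp

variable {b : EuclideanSpace ℝ (Fin n) → EuclideanSpace ℝ (Fin n)}
  {γ : C(Set.Icc (0 : ℝ) ℓ, EuclideanSpace ℝ (Fin n))}

theorem velocity_ae_eq (hb : Measurable b) (hb1 : ∀ x, ‖b x‖ ≤ 1)
    (hγ : ∀ t : Set.Icc (0 : ℝ) ℓ, γ t - γ ⟨0, Set.left_mem_Icc.2 hℓ.le⟩ =
      ∫ s in 0..t.1, b (Set.IccExtend hℓ.le γ s)) :
    ∀ᵐ t ∂(volume.restrict (Set.Icc 0 ℓ)), velocity hℓ γ t = b (curveExt hℓ γ t) := by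
  have hint := intervalIntegrable_comp_IccExtend hℓ.le hb hb1 γ 0 ℓ
  -- At the endpoints the constant continuation may destroy differentiability; they form a null set.
  rw [← restrict_Ioo_eq_restrict_Icc, ae_restrict_iff' measurableSet_Ioo]
  filter_upwards [hint.ae_hasDerivAt_integral] with t ht htm
  have htm' := Set.Ioo_subset_Icc_self htm
  have h0 : (0 : ℝ) ∈ Set.uIcc 0 ℓ := Set.left_mem_uIcc
  have h1 := ht (by rwa [Set.uIcc_of_le hℓ.le]) 0 h0
  have h2 := h1.const_add (γ ⟨0, Set.left_mem_Icc.2 hℓ.le⟩)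
  refine HasDerivAt.deriv (h2.congr_of_eventuallyEq ?_)
  filter_upwards [Ioo_mem_nhds htm.1 htm.2] with s hs
  have hs' := Set.Ioo_subset_Icc_self hs
  rw [← hγ ⟨s, hs'⟩, add_sub_cancel, curveExt, Set.IccExtend_of_mem _ _ hs']

theorem lipschitzWith_one_of_sub_eq_integral (hb1 : ∀ x, ‖b x‖ ≤ 1)
    (hγ : ∀ t : Set.Icc (0 : ℝ) ℓ, γ t - γ ⟨0, Set.left_mem_Icc.2 hℓ.le⟩ =
      ∫ s in 0..t.1, b (Set.IccExtend hℓ.le γ s)) (hb : Measurable b) : LipschitzWith 1 γ := by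
  have hint := fun r t => intervalIntegrable_comp_IccExtend hℓ.le hb hb1 γ r t
  refine LipschitzWith.of_dist_le_mul fun s t => ?_
  have h : γ s - γ t = ∫ r in t.1..s.1, b (Set.IccExtend hℓ.le γ r) := by
    rw [← intervalIntegral.integral_interval_sub_left (hint 0 s.1) (hint 0 t.1), ← hγ, ← hγ]
    abel
  rw [dist_eq_norm, h, Subtype.dist_eq, Real.dist_eq]
  exact intervalIntegral.norm_integral_le_of_norm_le_const fun r _ => hb1 _

theorem lipschitzWith_one_mem_lipCurves (hγ : LipschitzWith 1 γ) : γ ∈ lipCurves n hℓ := by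
  refine ⟨⟨1, hγ⟩, ae_of_all _ fun t => ?_⟩
  have h : LipschitzWith 1 (curveExt hℓ γ) := by
    have := hγ.comp (LipschitzWith.projIcc hℓ.le)
    rwa [one_mul] at this
  exact (norm_deriv_le_of_lipschitz h).trans_eq NNReal.coe_one

/-- The velocity is a function of the position, so it passes through the push-forward: repeated
visits to a point all contribute the same vector and cannot cancel. -/
theorem curveCharge_eq (hb : Measurable b)
    (hvel : ∀ᵐ t ∂(volume.restrict (Set.Icc 0 ℓ)), velocity hℓ γ t = b (curveExt hℓ γ t))
    (hb1 : ∀ x, ‖b x‖ ≤ 1) :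
    curveCharge hℓ γ = (occupationMeasure hℓ γ).withDensityᵥ b := by
  have hm := (continuous_curveExt hℓ γ).measurable
  have hi : Integrable b (occupationMeasure hℓ γ) :=
    Integrable.of_bound hb.aestronglyMeasurable 1 (ae_of_all _ hb1)
  have hi' : Integrable (fun t => b (curveExt hℓ γ t)) (volume.restrict (Set.Icc 0 ℓ)) :=
    hi.comp_measurable hm
  rw [curveCharge, WithDensityᵥEq.congr_ae hvel]
  ext1 A hA
  rw [VectorMeasure.map_apply _ hm hA, withDensityᵥ_apply hi' (hm hA), withDensityᵥ_apply hi hA,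
    occupationMeasure, setIntegral_map hA hb.aestronglyMeasurable hm.aemeasurable]

theorem variation_withDensityᵥ_of_norm_eq_one {X : Type*} [MeasurableSpace X] {τ : Measure X}
    [IsFiniteMeasure τ]
    {F : Type*} [NormedAddCommGroup F] [NormedSpace ℝ F] [CompleteSpace F] {f : X → F}
    (hf : AEStronglyMeasurable f τ) (hf1 : ∀ᵐ x ∂τ, ‖f x‖ = 1) :
    (τ.withDensityᵥ f).variation = τ := by
  rw [Measure.variation_withDensityᵥ (Integrable.of_bound hf 1 (hf1.mono fun x hx => hx.le))]
  conv_rhs => rw [← withDensity_one (μ := τ)]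
  refine withDensity_congr_ae (hf1.mono fun x hx => ?_)
  change ‖f x‖ₑ = 1
  rw [← ofReal_norm, hx]; simp
end

/-! ### The decomposition of a divergence free charge. -/

theorem mainTheorem4 (n : ℕ) (ℓ : ℝ) (hℓ : 0 < ℓ) (μ : Charge n) (hμ : μ.DivergenceFree) :
    ∃ ν : Measure (lipCurves n hℓ), IsFiniteMeasure ν ∧
      IsChargeIntegral hℓ μ ν ∧
      IsMeasureIntegral μ.variation (fun γ => (curveCharge hℓ γ.1).variation) ν ∧
      (∀ᵐ γ ∂ν, (∀ t : Set.Icc (0 : ℝ) ℓ, γ.1 t ∈ μ.supp) ∧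
        (curveCharge hℓ γ.1).variation Set.univ = curveLength hℓ γ.1 ∧
        curveLength hℓ γ.1 = ENNReal.ofReal ℓ) ∧
      IsMeasureIntegral μ.variation
        (fun γ => Measure.dirac (γ.1 ⟨0, Set.left_mem_Icc.2 hℓ.le⟩)) (ENNReal.ofReal ℓ • ν) ∧
      IsMeasureIntegral μ.variation
        (fun γ => Measure.dirac (γ.1 ⟨ℓ, Set.right_mem_Icc.2 hℓ.le⟩)) (ENNReal.ofReal ℓ • ν) := by
  classical
  have hfin := VectorMeasure.isFiniteMeasure_variation_euclideanSpace μ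
  obtain ⟨b, hb, hb1, hbae, hμb⟩ := VectorMeasure.exists_withDensityᵥ_variation μ
  set ρ := μ.variation with hρ
  have hact : ∀ φ, Integrable φ ρ → μ.act φ = ∫ x, inner ℝ (φ x) (b x) ∂ρ := fun φ hφ => by
    rw [Charge.act, hμb,
        Measure.integral_withDensityᵥ_of_norm_eq_one _ hb.aestronglyMeasurable hbae hφ]
    rfl
  have hdiv : ∀ ψ : EuclideanSpace ℝ (Fin n) → ℝ, ContDiff ℝ ∞ ψ → HasCompactSupport ψ →
      ∫ x, fderiv ℝ ψ x (b x) ∂ρ = 0 := by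
    intro ψ hψ hψ'
    have h1 : Continuous (gradient ψ) :=
      (InnerProductSpace.toDual ℝ (EuclideanSpace ℝ (Fin n))).symm.continuous.comp
        (hψ.continuous_fderiv (by simp))
    have h2 : HasCompactSupport (gradient ψ) := by
      exact (hψ'.fderiv ℝ).comp_left (map_zero _)
    have h3 := hμ ψ hψ hψ'
    obtain ⟨A, hA⟩ := h1.bounded_above_of_compact_support h2
    rw [Charge.div, neg_eq_zero, hact _
        (Integrable.of_bound h1.aestronglyMeasurable A (ae_of_all _ hA))] at h3
    rw [← h3]
    refine integral_congr_ae (ae_of_all _ fun x => ?_)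
    simp [gradient]
  obtain ⟨ζ, hζfin, hζ, hζae⟩ := exists_superposition hℓ.le ρ hb hb1 hdiv
  -- transfer to the space of Lipschitz curves
  have hLm : MeasurableSet
      {γ : C(Set.Icc (0 : ℝ) ℓ, EuclideanSpace ℝ (Fin n)) | LipschitzWith 1 γ} :=
    isClosed_setOf_lipschitzWith_one.measurableSet
  -- Replacing the `ζ`-null set of other curves by the constant curve `0` gives a measurable map
  -- into `lipCurves n hℓ`, without any measurability of that set.
  let p : C(Set.Icc (0 : ℝ) ℓ, EuclideanSpace ℝ (Fin n)) →
      C(Set.Icc (0 : ℝ) ℓ, EuclideanSpace ℝ (Fin n)) := fun γ => if LipschitzWith 1 γ then γ else 0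
  have hpm : Measurable p := Measurable.ite hLm measurable_id measurable_const
  have hpL : ∀ γ, p γ ∈ lipCurves n hℓ := fun γ => by
    refine lipschitzWith_one_mem_lipCurves hℓ ?_
    simp only [p]
    split_ifs with h
    · exact h
    · exact LipschitzWith.const' 0
  let q : C(Set.Icc (0 : ℝ) ℓ, EuclideanSpace ℝ (Fin n)) → lipCurves n hℓ := fun γ => ⟨p γ, hpL γ⟩
  have hq : Measurable q := hpm.subtype_mk
  have hqae : ∀ᵐ γ ∂ζ, (q γ).1 = γ := hζae.mono fun γ hγ => by
    simp [q, p, lipschitzWith_one_of_sub_eq_integral hℓ hb1 hγ hb]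
  have hval : (ζ.map q).map Subtype.val = ζ := by
    rw [Measure.map_map measurable_subtype_coe hq]
    exact (Measure.map_congr hqae).trans Measure.map_id
  have hℓ0 : ENNReal.ofReal ℓ ≠ 0 := by simpa using hℓ
  have hℓt : ENNReal.ofReal ℓ ≠ ⊤ := ENNReal.ofReal_ne_top
  -- The factor compensates the average occupation measure `ℓ ρ`.
  set ν := (ENNReal.ofReal ℓ)⁻¹ • ζ.map q with hν
  have hνae : ∀ P : C(Set.Icc (0 : ℝ) ℓ, EuclideanSpace ℝ (Fin n)) → Prop, (∀ᵐ γ ∂ζ, P γ) →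
      ∀ᵐ γ ∂ν, P γ.1 := by
    intro P hP
    rw [← hval] at hP
    exact Measure.ae_smul_measure (ae_of_ae_map measurable_subtype_coe.aemeasurable hP) _
  have hνlin : ∀ F : C(Set.Icc (0 : ℝ) ℓ, EuclideanSpace ℝ (Fin n)) → ℝ≥0∞, Measurable F →
      ∫⁻ γ, F γ.1 ∂ν = (ENNReal.ofReal ℓ)⁻¹ * ∫⁻ γ, F γ ∂ζ := by
    intro F hF
    rw [hν, lintegral_smul_measure, smul_eq_mul]
    conv_rhs => rw [← hval]
    rw [lintegral_map hF measurable_subtype_coe]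
  have hextm := measurable_uncurry_IccExtend (E := EuclideanSpace ℝ (Fin n)) hℓ.le
  have hoccm : ∀ A : Set (EuclideanSpace ℝ (Fin n)), MeasurableSet A →
      Measurable fun γ : C(Set.Icc (0 : ℝ) ℓ, EuclideanSpace ℝ (Fin n)) =>
          occupationMeasure hℓ γ A := by
    intro A hA
    simp_rw [occupationMeasure_apply hℓ _ hA]
    exact Measurable.lintegral_prod_right'
      (f := fun p : C(Set.Icc (0 : ℝ) ℓ, EuclideanSpace ℝ (Fin n)) × ℝ => A.indicator
          (1 : EuclideanSpace ℝ (Fin n) → ℝ≥0∞) (Set.IccExtend hℓ.le p.1 p.2))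
      ((measurable_one.indicator hA).comp hextm)
  have hocclin : ∀ A : Set (EuclideanSpace ℝ (Fin n)), MeasurableSet A →
      ∫⁻ γ, occupationMeasure hℓ γ A ∂ζ = ENNReal.ofReal ℓ * ρ A := by
    intro A hA
    simp_rw [occupationMeasure_apply hℓ _ hA]
    have := lintegral_lintegral_IccExtend hℓ.le hζ (measurable_one.indicator hA)
    rwa [lintegral_indicator_one hA] at this
  -- The set where `|b| ≠ 1` is `ρ`-null, so its mean occupation time vanishes.
  have hbocc : ∀ᵐ γ ∂ζ, ∀ᵐ x ∂(occupationMeasure hℓ γ), ‖b x‖ = 1 := by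
    have hms : MeasurableSet {x | ‖b x‖ = 1}ᶜ :=
      (measurableSet_eq_fun hb.norm measurable_const).compl
    have h0 := hocclin _ hms
    rw [show ρ {x | ‖b x‖ = 1}ᶜ = 0 from hbae, mul_zero, lintegral_eq_zero_iff (hoccm _ hms)] at h0
    exact h0
  have hsupp : ∀ᵐ γ ∂ζ, ∀ t : Set.Icc (0 : ℝ) ℓ, γ t ∈ μ.supp := by
    obtain ⟨D, hDc, hDd⟩ := TopologicalSpace.exists_countable_dense (Set.Icc (0 : ℝ) ℓ)
    have h1 : ∀ t : Set.Icc (0 : ℝ) ℓ, ∀ᵐ γ ∂ζ, γ t ∈ μ.supp := fun t => by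
      have h2 : ∀ᵐ x ∂ζ.map (fun γ : C(Set.Icc (0 : ℝ) ℓ, EuclideanSpace ℝ (Fin n)) => γ t),
          x ∈ μ.supp := by
        rw [hζ t]
        exact Measure.support_mem_ae
      exact ae_of_ae_map (measurable_curve_eval t).aemeasurable h2
    filter_upwards [(ae_ball_iff hDc).2 fun t _ => h1 t] with γ hγ t
    have hcl : IsClosed (γ ⁻¹' μ.supp) := Measure.isClosed_support.preimage γ.continuous
    exact hcl.closure_subset_iff.2 hγ (hDd t)
  have hchar : ∀ᵐ γ ∂ζ, curveCharge hℓ γ = (occupationMeasure hℓ γ).withDensityᵥ b ∧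
      (∀ᵐ x ∂(occupationMeasure hℓ γ), ‖b x‖ = 1) ∧
      (curveCharge hℓ γ).variation = occupationMeasure hℓ γ ∧
      curveLength hℓ γ = ENNReal.ofReal ℓ := by
    filter_upwards [hζae, hbocc] with γ hγ hγb
    have hvel := velocity_ae_eq hℓ hb hb1 hγ
    have h1 := curveCharge_eq hℓ hb hvel hb1
    refine ⟨h1, hγb, ?_, ?_⟩
    · rw [h1, variation_withDensityᵥ_of_norm_eq_one hb.aestronglyMeasurable hγb]
    · have h2 := ae_of_ae_map (continuous_curveExt hℓ γ).measurable.aemeasurable hγb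
      rw [curveLength, ← occupationMeasure_univ hℓ γ,
          occupationMeasure_apply hℓ γ MeasurableSet.univ]
      refine lintegral_congr_ae ?_
      filter_upwards [hvel, h2] with t ht1 ht2
      rw [ht1, ← ofReal_norm, ht2]
      simp
  have hdirac : ∀ t : Set.Icc (0 : ℝ) ℓ, IsMeasureIntegral ρ
      (fun γ : lipCurves n hℓ => Measure.dirac (γ.1 t)) (ENNReal.ofReal ℓ • ν) := by
    intro t A hA
    have hm : Measurable fun γ : C(Set.Icc (0 : ℝ) ℓ, EuclideanSpace ℝ (Fin n)) => A.indicator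
        (1 : EuclideanSpace ℝ (Fin n) → ℝ≥0∞) (γ t) :=
      (measurable_one.indicator hA).comp (measurable_curve_eval t)
    simp_rw [Measure.dirac_apply' _ hA]
    refine ⟨(hm.comp measurable_subtype_coe).aemeasurable, ?_⟩
    rw [lintegral_smul_measure, smul_eq_mul,
      hνlin (fun γ => A.indicator (1 : EuclideanSpace ℝ (Fin n) → ℝ≥0∞) (γ t)) hm, ← mul_assoc,
      ENNReal.mul_inv_cancel hℓ0 hℓt, one_mul,
      ← lintegral_map (measurable_one.indicator hA) (measurable_curve_eval t), hζ t,
      lintegral_indicator_one hA]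
  have hνfin : IsFiniteMeasure ν := by
    have := Measure.isFiniteMeasure_map ζ q
    exact Measure.smul_finite _ (ENNReal.inv_ne_top.2 hℓ0)
  refine ⟨ν, hνfin, ?_, ?_, ?_, hdirac _, hdirac _⟩
  · intro φ hφ hφ'
    obtain ⟨A, hA⟩ := hφ.bounded_above_of_compact_support hφ'
    have hφm := hφ.measurable
    let f : EuclideanSpace ℝ (Fin n) → ℝ := fun x => inner ℝ (φ x) (b x)
    have hfm : Measurable f := hφm.inner hb
    have hfA : ∀ x, ‖f x‖ ≤ A := fun x => (norm_inner_le_norm _ _).trans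
      ((mul_le_of_le_one_right (norm_nonneg _) (hb1 x)).trans (hA x))
    let H : C(Set.Icc (0 : ℝ) ℓ, EuclideanSpace ℝ (Fin n)) → ℝ := fun γ => ∫ s in Set.Icc 0 ℓ, f
        (Set.IccExtend hℓ.le γ s)
    have hint : Integrable
        (fun p : C(Set.Icc (0 : ℝ) ℓ, EuclideanSpace ℝ (Fin n)) × ℝ => f
        (Set.IccExtend hℓ.le p.1 p.2))
        (ζ.prod (volume.restrict (Set.Icc 0 ℓ))) :=
      Integrable.of_bound (hfm.comp hextm).aestronglyMeasurable A (ae_of_all _ fun p => hfA _)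
    have hHi : Integrable H ζ := hint.integral_prod_left
    have hae : ∀ᵐ γ : lipCurves n hℓ ∂ν, (curveCharge hℓ γ.1).act φ = H γ.1 := by
      refine hνae (fun γ => (curveCharge hℓ γ).act φ = H γ) (hchar.mono fun γ hγ => ?_)
      rw [Charge.act, hγ.1, Measure.integral_withDensityᵥ_of_norm_eq_one _ hb.aestronglyMeasurable
        hγ.2.1 (Integrable.of_bound hφ.aestronglyMeasurable A (ae_of_all _ hA))]
      exact integral_map (continuous_curveExt hℓ γ).measurable.aemeasurable
        hfm.aestronglyMeasurable
    have hHν : Integrable (fun γ : lipCurves n hℓ => H γ.1) ν := by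
      refine Integrable.smul_measure ?_ (ENNReal.inv_ne_top.2 hℓ0)
      rw [← hval] at hHi
      exact hHi.comp_measurable measurable_subtype_coe
    refine ⟨hHν.congr (hae.mono fun γ hγ => hγ.symm), ?_⟩
    have hHζ : ∫ γ, H γ ∂ζ = ℓ * ∫ x, f x ∂ρ := by
      rw [integral_integral_swap
          (f := fun (γ : C(Set.Icc (0 : ℝ) ℓ, EuclideanSpace ℝ (Fin n))) (s : ℝ) => f
          (Set.IccExtend hℓ.le γ s)) hint]
      have h1 : ∀ s : ℝ, ∫ γ : C(Set.Icc (0 : ℝ) ℓ, EuclideanSpace ℝ (Fin n)), f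
          (Set.IccExtend hℓ.le γ s) ∂ζ = ∫ x, f x ∂ρ := fun s => by
        rw [← hζ (Set.projIcc 0 ℓ hℓ.le s),
          integral_map (measurable_curve_eval _).aemeasurable hfm.aestronglyMeasurable]
        rfl
      simp_rw [h1]
      rw [setIntegral_const]
      simp [hℓ.le]
    have hHval : ∫ γ, H γ.1 ∂(ζ.map q) = ∫ γ, H γ ∂ζ := by
      conv_rhs => rw [← hval]
      rw [integral_map measurable_subtype_coe.aemeasurable]
      rw [hval]
      exact hHi.aestronglyMeasurable
    rw [integral_congr_ae hae, hν, integral_smul_measure, hHval, hHζ,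
      hact φ (Integrable.of_bound hφ.aestronglyMeasurable A (ae_of_all _ hA)), ENNReal.toReal_inv,
      ENNReal.toReal_ofReal hℓ.le, smul_eq_mul, ← mul_assoc, inv_mul_cancel₀ hℓ.ne', one_mul]
  · intro A hA
    have hae : ∀ᵐ γ : lipCurves n hℓ ∂ν,
        (curveCharge hℓ γ.1).variation A = occupationMeasure hℓ γ.1 A :=
      hνae (fun γ => (curveCharge hℓ γ).variation A = occupationMeasure hℓ γ A)
        (hchar.mono fun γ hγ => by rw [hγ.2.2.1])
    -- Measurability of the variation in `γ` comes from its almost sure equality with the occupation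
    -- measure.
    refine ⟨⟨_, (hoccm A hA).comp measurable_subtype_coe, hae⟩, ?_⟩
    rw [lintegral_congr_ae hae, hνlin _ (hoccm A hA), hocclin A hA, ← mul_assoc,
      ENNReal.inv_mul_cancel hℓ0 hℓt, one_mul]
  · refine hνae (fun γ => (∀ t : Set.Icc (0 : ℝ) ℓ, γ t ∈ μ.supp) ∧
        (curveCharge hℓ γ).variation Set.univ = curveLength hℓ γ ∧
        curveLength hℓ γ = ENNReal.ofReal ℓ) ?_
    filter_upwards [hsupp, hchar] with γ h1 h2
    exact ⟨h1, by rw [h2.2.2.1, h2.2.2.2, occupationMeasure_univ], h2.2.2.2⟩
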